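/- Let $2\le p\le n-2$ and $\beta>0$. Let $\mathrm{St}(n,p)=\{X\in\mathbb R^{n\times p}: X^\top X=I_p\}$, with tangent spaces $T_X=\{\xi\in\mathbb R^{n\times p}: X^\top\xi+\xi^\top X=0\}$. Let $\mathrm{St}_\beta(n,p)$ be this manifold with the Riemannian metric which, for $Q\in\mathrm O(n)$ and $I_{n\times p}=\begin{bmatrix}I_p\\0\end{bmatrix}$, is given at $QI_{n\times p}$ by $$g\left(Q\begin{bmatrix}A_1\\H_1\end{bmatrix},Q\begin{bmatrix}A_2\\H_2\end{bmatrix}\right)=\beta\,\mathrm{tr}(A_1^\top A_2)+\mathrm{tr}(H_1^\top H_2)$$ for skew-symmetric $A_1,A_2\in\mathbb R^{p\times p}$ and arbitrary $H_1,H_2\in\mathbb R^{(n-p)\times p}$. Let $\mathrm{Exp}_X$ be its Riemannian exponential map at $X$. For a geodesic $\gamma$ with $\gamma(0)=X$, the point $\gamma(t)$ is called conjugate to $\gamma(0)$ along $\gamma$ if $t\gamma'(0)$ is a critical point of $\mathrm{Exp}_X$, i.e. if the derivative of $\mathrm{Exp}_X$ there is singular. The conjugate radius $\mathrm{conj}(X)$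 at $X$ is the supremum of the radii of the open balls centered at the origin of $T_X$ (for the norm given by $g$) that contain no critical point of $\mathrm{Exp}_X$; the conjugate radius of $\mathrm{St}_\beta(n,p)$ is $\inf_X\mathrm{conj}(X)$. Put $\alpha=\frac1{2\beta}-1$. Then the set $\{t>0:\frac{\sin t}{t}+(1+2\alpha)\cos t=0\}$ has a smallest element; denote it by $t^{\mathrm r}_\beta$. Let $Q\in\mathrm O(n)$ and $\xi=Q\begin{bmatrix}0\\H\end{bmatrix}\in T_{QI_{n\times p}}$, where $H=\begin{bmatrix}I_2&0\\0&0\end{bmatrix}\in\mathbb R^{(n-p)\times p}$. The geodesic $\gamma$ of $\mathrm{St}_\beta(n,p)$ with $\gamma(0)=QI_{n\times p}$ and $\gamma'(0)=\xi$ is $$\gamma(t)=Q\exp\left(t\begin{bmatrix}0&-H^\top\\H&0\end{bmatrix}\right)I_{n\times p},$$ and the following hold. 1. $\gamma(t^{\mathrm r}_\beta)$ and $\gamma(\pi)$ are conjugate to $\gamma(0)$ along $\gamma$. 2. $\gamma$ has constant speed $\sqrt2$, so that for all $T>0$ its length between $t=0$ and $t=T$ is $T\sqrt2$. 3. At every point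 of $\mathrm{St}_\beta(n,p)$ the conjugate radius is at most $\sqrt2\,\min\{t^{\mathrm r}_\beta,\pi\}$; hence so is the conjugate radius of $\mathrm{St}_\beta(n,p)$. 4. The minimum equals $t^{\mathrm r}_\beta$ when $\beta\le1$ and $\pi$ when $\beta\ge1$. -/

import Mathlib

open scoped Matrix ContDiff ENNReal NNReal

/- Spaces of real matrices carry the ℓ^∞ operator norm. It only serves to speak of derivatives
and smoothness, which do not depend on the choice of a norm in finite dimension. -/
open scoped Matrix.Norms.Operator

noncomputable section

namespace StiefelConj

section Riemannian

variable {E : Type*} [NormedAddCommGroup E] [NormedSpace ℝ E]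

/-- Christoffel symbols of the first kind of a metric `g` on (an open set of) a vector space `E`:
`Γ_x(u, v; w) = ½ (D_u g(v, w) + D_v g(u, w) - D_w g(u, v))`, so that the Levi-Civita connection
satisfies `g(∇_u V, w) = g(D_u V, w) + Γ(u, V; w)`. -/
def christoffel (g : E → E → E → ℝ) (x u v w : E) : ℝ :=
  (1 / 2) * (fderiv ℝ (fun y => g y v w) x u + fderiv ℝ (fun y => g y u w) x v
    - fderiv ℝ (fun y => g y u v) x w)

/-- `γ : ℝ → E` is a geodesic of the submanifold `M` of `E`, with tangent spaces `T x`, for the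
Riemannian metric that `g` restricts to on `M`: it is smooth, runs in `M`, and its covariant
acceleration `∇_{γ'} γ'` for the Levi-Civita connection of `M` vanishes. The latter is the
tangential part of the covariant acceleration with respect to `g` on a neighbourhood of `M`,
hence it vanishes iff the pairing below is zero for all tangent vectors `η`
(this condition depends on `g` through the inner products on the tangent spaces of `M` only). -/
structure IsGeodesic (g : E → E → E → ℝ) (M : Set E) (T : E → Submodule ℝ E)
    (γ : ℝ → E) : Prop where
  smooth : ContDiff ℝ ∞ γ
  mem : ∀ t, γ t ∈ M
  geodesic_eq : ∀ t, ∀ η ∈ T (γ t),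
    g (γ t) (deriv (deriv γ) t) η + christoffel g (γ t) (deriv γ t) (deriv γ t) η = 0

/-- The norm of the tangent vector `ξ` at `x`. -/
def metricNorm (g : E → E → E → ℝ) (x ξ : E) : ℝ := √(g x ξ ξ)

/-- The length of `γ` between the times `a` and `b`. -/
def curveLength (g : E → E → E → ℝ) (γ : ℝ → E) (a b : ℝ) : ℝ :=
  ∫ t in a..b, metricNorm g (γ t) (deriv γ t)

open Classical in
/-- The Riemannian exponential `Exp_x : T_x M → M`, `ξ ↦ γ_ξ(1)`, where `γ_ξ` is the geodesic with
`γ_ξ(0) = x` and `γ_ξ'(0) = ξ` (for a complete `M` it exists and is unique; `0` is a dummy value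
otherwise). -/
def riemExp (g : E → E → E → ℝ) (M : Set E) (T : E → Submodule ℝ E) (x : E) (ξ : T x) : E :=
  if h : ∃ γ : ℝ → E, IsGeodesic g M T γ ∧ γ 0 = x ∧ deriv γ 0 = (ξ : E) then
    Classical.choose h 1
  else 0

/-- `v ∈ T_x M` is a critical point of `Exp_x`: the derivative of `Exp_x` at `v` exists and is
singular. It maps `T_x M` to a tangent space of `M` of the same dimension, so singular means
not injective. -/
def IsCriticalPoint (g : E → E → E → ℝ) (M : Set E) (T : E → Submodule ℝ E) (x : E)
    (v : T x) : Prop :=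
  ∃ L : T x →L[ℝ] E, HasFDerivAt (riemExp g M T x) L v ∧ ¬ Function.Injective L

/-- `γ` is a geodesic and `γ(t)` is conjugate to `γ(0)` along `γ`: the vector `t γ'(0)` is a
critical point of `Exp_{γ(0)}`. -/
def IsConjugateAlong (g : E → E → E → ℝ) (M : Set E) (T : E → Submodule ℝ E) (γ : ℝ → E)
    (t : ℝ) : Prop :=
  IsGeodesic g M T γ ∧
    ∃ v : T (γ 0), (v : E) = t • deriv γ 0 ∧ IsCriticalPoint g M T (γ 0) v

/-- The conjugate radius at `x`: the supremum of the radii `r` of open balls centered at the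
origin of `T_x M` that contain no critical point of `Exp_x`. -/
def conjRadiusAt (g : E → E → E → ℝ) (M : Set E) (T : E → Submodule ℝ E) (x : E) : ℝ≥0∞ :=
  ⨆ (r : ℝ≥0) (_ : ∀ v : T x, metricNorm g x (v : E) < r → ¬ IsCriticalPoint g M T x v),
    (r : ℝ≥0∞)

/-- The conjugate radius of `M`: the infimum of the conjugate radii at its points. -/
def conjRadius (g : E → E → E → ℝ) (M : Set E) (T : E → Submodule ℝ E) : ℝ≥0∞ :=
  ⨅ x ∈ M, conjRadiusAt g M T x

end Riemannian

section Stiefel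

variable {n p : ℕ}

/-- The Stiefel manifold of orthonormal `p`-frames in `ℝⁿ`. -/
def stiefel (n p : ℕ) : Set (Matrix (Fin n) (Fin p) ℝ) := {X | Xᵀ * X = 1}

/-- The tangent space to the Stiefel manifold at `X`. -/
def tangent (X : Matrix (Fin n) (Fin p) ℝ) : Submodule ℝ (Matrix (Fin n) (Fin p) ℝ) where
  carrier := {ξ | Xᵀ * ξ + ξᵀ * X = 0}
  zero_mem' := by simp
  add_mem' := by
    intro a b ha hb
    simp only [Set.mem_ofPred_eq, Matrix.mul_add, Matrix.transpose_add, Matrix.add_mul] at *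
    rw [add_add_add_comm, ha, hb, add_zero]
  smul_mem' := by
    intro c a ha
    simp only [Set.mem_ofPred_eq, Matrix.mul_smul, Matrix.transpose_smul, Matrix.smul_mul] at *
    rw [← smul_add, ha, smul_zero]

/-- The metric `g` of `St_β(n, p)`. For `X` in the Stiefel manifold and tangent vectors
`ξ = X A + X_⊥ H`, `η = X B + X_⊥ K` it is `β tr(Aᵀ B) + tr(Hᵀ K)`, because `A = Xᵀ ξ`,
`B = Xᵀ η` and `X_⊥ X_⊥ᵀ = 1 - X Xᵀ`; see `metric_apply` below. -/
def metric (β : ℝ) (X ξ η : Matrix (Fin n) (Fin p) ℝ) : ℝ :=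
  β * ((Xᵀ * ξ)ᵀ * (Xᵀ * η)).trace + (ξᵀ * (1 - X * Xᵀ) * η).trace

/-- The index set `{1, …, n}` cut into its first `p` and its last `n - p` elements. -/
def split (h : p ≤ n) : Fin p ⊕ Fin (n - p) ≃ Fin n :=
  finSumFinEquiv.trans (finCongr (Nat.add_sub_of_le h))

/-- The block matrix `[A; H]`. -/
def stack (h : p ≤ n) (A : Matrix (Fin p) (Fin p) ℝ) (H : Matrix (Fin (n - p)) (Fin p) ℝ) :
    Matrix (Fin n) (Fin p) ℝ :=
  Matrix.reindex (split h) (Equiv.refl _) (Matrix.fromRows A H)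

/-- The matrix `I_{n×p} = [I_p; 0]`. -/
def frame (h : p ≤ n) : Matrix (Fin n) (Fin p) ℝ := stack h 1 0

/-- The block matrix `[2βA, -Hᵀ; H, 0]`. -/
def omega (h : p ≤ n) (β : ℝ) (A : Matrix (Fin p) (Fin p) ℝ)
    (H : Matrix (Fin (n - p)) (Fin p) ℝ) : Matrix (Fin n) (Fin n) ℝ :=
  Matrix.reindex (split h) (split h) (Matrix.fromBlocks ((2 * β) • A) (-Hᵀ) H 0)

/-- The block matrix `[I_2, 0; 0, 0]` of size `(n - p) × p`. -/
def hMat (n p : ℕ) : Matrix (Fin (n - p)) (Fin p) ℝ :=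
  Matrix.of fun i j => if (i : ℕ) = (j : ℕ) ∧ (j : ℕ) < 2 then 1 else 0

/-- The positive solutions of `sin t / t + (1 + 2α) cos t = 0`, where `α = 1 / (2β) - 1`. -/
def rootSet (β : ℝ) : Set ℝ :=
  {t | 0 < t ∧ Real.sin t / t + (1 + 2 * (1 / (2 * β) - 1)) * Real.cos t = 0}

/-- The smallest element of `rootSet β`. -/
def tRoot (β : ℝ) : ℝ := sInf (rootSet β)

theorem frame_eq (h : p ≤ n) :
    (frame h : Matrix (Fin n) (Fin p) ℝ)ᵀ =
      (Matrix.fromCols 1 0).submatrix id (split h).symm := by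
  ext i j
  rcases hj : (split h).symm j with k | k <;>
    simp [frame, stack, hj, Matrix.one_apply, eq_comm]

/-- The metric in the coordinates `ξ = Q [A; H]` of the tangent space at `Q I_{n×p}`. -/
theorem metric_apply (h : p ≤ n) (β : ℝ) (Q : Matrix (Fin n) (Fin n) ℝ)
    (hQ : Q ∈ Matrix.orthogonalGroup (Fin n) ℝ) (A B : Matrix (Fin p) (Fin p) ℝ)
    (H K : Matrix (Fin (n - p)) (Fin p) ℝ) :
    metric β (Q * frame h) (Q * stack h A H) (Q * stack h B K) =
      β * (Aᵀ * B).trace + (Hᵀ * K).trace := by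
  have hQ' : Qᵀ * Q = 1 := by
    have := (Matrix.mem_orthogonalGroup_iff' (Fin n) ℝ).1 hQ
    simpa [Matrix.star_eq_conjTranspose] using this
  have key (C : Matrix (Fin p) (Fin p) ℝ) (L : Matrix (Fin (n - p)) (Fin p) ℝ) :
      (Q * frame h)ᵀ * (Q * stack h C L) = C := by
    rw [Matrix.transpose_mul, Matrix.mul_assoc, ← Matrix.mul_assoc Qᵀ, hQ', Matrix.one_mul,
      frame_eq, stack, Matrix.reindex_apply, Matrix.submatrix_mul_equiv,
      Matrix.fromCols_mul_fromRows]
    ext i j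
    simp
  have key2 : (Q * stack h A H)ᵀ * (Q * stack h B K) = Aᵀ * B + Hᵀ * K := by
    rw [Matrix.transpose_mul, Matrix.mul_assoc, ← Matrix.mul_assoc Qᵀ, hQ', Matrix.one_mul,
      stack, stack, Matrix.reindex_apply, Matrix.reindex_apply, Matrix.transpose_submatrix,
      Matrix.submatrix_mul_equiv, Matrix.transpose_fromRows, Matrix.fromCols_mul_fromRows]
    ext i j
    simp
  have key3 : (Q * stack h A H)ᵀ * (Q * frame h) = Aᵀ := by
    rw [← Matrix.transpose_transpose (Q * frame h), ← Matrix.transpose_mul, key]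
  rw [metric, key, key, Matrix.mul_sub, Matrix.sub_mul, Matrix.mul_one, key2,
    ← Matrix.mul_assoc _ (Q * frame h), key3, Matrix.mul_assoc, key]
  simp

end Stiefel

end StiefelConj

end

/-! Everything rests on an explicit formula for the exponential map. Differentiating `Xᵀ * X = 1`
twice fixes the normal part of the acceleration of a curve, and the geodesic equation fixes its
tangential part, so geodesics solve the second-order equation γ'' = `accel β γ γ'`. The curve Q
exp(tΩ) I exp(t(1 - 2β)A), with Ω = `omega h β A H`, solves it, and uniqueness for ODEs identifies
the value of this curve at time 1 with `riemExp` (`riemExp_eq_expFormula`). Conjugate points are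
then zeros of the derivative of a product of matrix exponentials.

At tH the derivative is computed on a two-dimensional space of directions (aJ, kHJ), where J is skew
and supported where the partial isometry H is isometric. The increment of Ω splits into a part N
commuting with Ω₀ = `omega h β 0 H` and a part M anticommuting with it. The derivative of exp
multiplies the first by exp(tΩ₀) and the second by sin t / t (`fderiv_exp_omega`). The image
therefore has only two coefficients: on J, (1 - β) a cos t + β a sin t / t; on HJ, (1 - β) a sin t +
k sin t / t. They vanish for a = 1, k = -(1 - β)t when t is a root of sin t / t + (1/β - 1) cos t,
and for a = 0, k = 1 when t = π. Note that 1 + 2α = 1/β - 1.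

Such critical vectors have norm t√2. Every point of the manifold has the form Q I with Q orthogonal,
so the bound on the conjugate radius holds everywhere. The comparison of the first root with π is a
sign analysis of sin t + (1/β - 1) t cos t. -/

namespace StiefelConj

/-! ### The first positive root and its position relative to π -/

section RootSet

theorem mem_rootSet_iff {β t : ℝ} (ht : 0 < t) :
    t ∈ rootSet β ↔ Real.sin t + (1 / β - 1) * t * Real.cos t = 0 := by
  have key : Real.sin t / t + (1 + 2 * (1 / (2 * β) - 1)) * Real.cos t
      = (Real.sin t + (1 / β - 1) * t * Real.cos t) / t := by
    have h2 : 2 * (1 / (2 * β)) = 1 / β := by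
      rw [mul_one_div, mul_comm 2 β, div_mul_cancel_right₀ two_ne_zero, one_div]
    rw [mul_sub, h2]
    field_simp
    ring
  simp only [rootSet, Set.mem_ofPred_eq, ht, true_and, key, div_eq_zero_iff, ht.ne', or_false]

/-- Since tan t > t, already sin t - t cos t is positive before π/2. Hence every root is at least
π/2, which keeps the root set closed despite the open condition t > 0. -/
theorem sin_add_mul_cos_pos {β t : ℝ} (hβ : 0 < β) (h0 : 0 < t) (h1 : t ≤ Real.pi / 2) :
    0 < Real.sin t + (1 / β - 1) * t * Real.cos t := by
  have hc : 0 ≤ Real.cos t := Real.cos_nonneg_of_neg_pi_div_two_le_of_le (by linarith) h1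
  rcases h1.eq_or_lt with rfl | h1
  · simp
  have hc : 0 < Real.cos t := Real.cos_pos_of_mem_Ioo ⟨by linarith, h1⟩
  have htan := Real.lt_tan h0 h1
  rw [Real.tan_eq_sin_div_cos, lt_div_iff₀ hc] at htan
  have : 0 < 1 / β * t * Real.cos t := by positivity
  linarith

theorem rootSet_eq {β : ℝ} (hβ : 0 < β) :
    rootSet β = {t | Real.pi / 2 ≤ t ∧ Real.sin t + (1 / β - 1) * t * Real.cos t = 0} := by
  have hpi := Real.pi_pos
  ext t
  constructor
  · intro h
    have h0 := (mem_rootSet_iff h.1).1 h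
    refine ⟨?_, h0⟩
    by_contra! hlt
    exact (sin_add_mul_cos_pos hβ h.1 hlt.le).ne' h0
  · rintro ⟨h1, h0⟩
    exact (mem_rootSet_iff (by linarith)).2 h0

/-- Intermediate value theorem: the function equals 1 at π/2. -/
theorem exists_mem_rootSet {β b : ℝ} (hβ : 0 < β) (hb : Real.pi / 2 ≤ b)
    (h : Real.sin b + (1 / β - 1) * b * Real.cos b ≤ 0) : ∃ t ∈ rootSet β, t ≤ b := by
  have hcont : ContinuousOn (fun t : ℝ => Real.sin t + (1 / β - 1) * t * Real.cos t)
      (Set.Icc (Real.pi / 2) b) := by fun_prop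
  obtain ⟨t, ht, h0⟩ := intermediate_value_Icc' hb hcont
    (show (0 : ℝ) ∈ _ from ⟨h, by simp⟩)
  exact ⟨t, by rw [rootSet_eq hβ]; exact ⟨ht.1, h0⟩, ht.2⟩

theorem isLeast_tRoot {β : ℝ} (hβ : 0 < β) : IsLeast (rootSet β) (tRoot β) := by
  have hpi := Real.pi_pos
  have hbdd : BddBelow (rootSet β) := ⟨0, fun t ht => ht.1.le⟩
  have hne : (rootSet β).Nonempty := by
    -- At 3π/2 the cosine vanishes and the sine is -1, whatever β is.
    obtain ⟨t, ht, -⟩ := exists_mem_rootSet (b := Real.pi / 2 + Real.pi) hβ (by linarith)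
      (by simp [Real.sin_add_pi, Real.cos_add_pi])
    exact ⟨t, ht⟩
  have hcl : IsClosed (rootSet β) := by
    rw [rootSet_eq hβ]
    exact (isClosed_le continuous_const continuous_id).inter
      (isClosed_eq (by fun_prop) continuous_const)
  exact ⟨hcl.csInf_mem hne hbdd, fun t ht => csInf_le hbdd ht⟩

theorem tRoot_le_pi {β : ℝ} (hβ : 0 < β) (h1 : β ≤ 1) : tRoot β ≤ Real.pi := by
  have hc : 1 ≤ 1 / β := by rwa [le_div_iff₀ hβ, one_mul]
  obtain ⟨t, ht, hle⟩ := exists_mem_rootSet (b := Real.pi) hβ (by linarith [Real.pi_pos])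
    (by simp only [Real.sin_pi, Real.cos_pi]; nlinarith [Real.pi_pos])
  exact ((isLeast_tRoot hβ).2 ht).trans hle

/-- On [π/2, π) both 1/β - 1 and cos t are nonpositive while sin t is positive, so no root lies
there. -/
theorem pi_le_tRoot {β : ℝ} (h1 : 1 ≤ β) : Real.pi ≤ tRoot β := by
  have hβ : 0 < β := by linarith
  have hmem := (isLeast_tRoot hβ).1
  rw [rootSet_eq hβ] at hmem
  obtain ⟨hge, h0⟩ := hmem
  by_contra! hlt
  have hpi := Real.pi_pos
  have hsin := Real.sin_pos_of_pos_of_lt_pi (by linarith) hlt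
  have hcos : Real.cos (tRoot β) ≤ 0 :=
    Real.cos_nonpos_of_pi_div_two_le_of_le hge (by linarith)
  have hc : 1 / β ≤ 1 := by rwa [div_le_iff₀ hβ, one_mul]
  have : 0 ≤ (1 - 1 / β) * tRoot β * -Real.cos (tRoot β) :=
    mul_nonneg (mul_nonneg (by linarith) (by linarith)) (by linarith)
  nlinarith

end RootSet

/-! ### Derivatives of matrix products and uniqueness for ODEs -/

section Calculus

variable {l m n : Type*} [Fintype l] [Fintype m] [Fintype n]

theorem isBoundedBilinearMap_matrix_mul :
    IsBoundedBilinearMap ℝ (fun q : Matrix l m ℝ × Matrix m n ℝ => q.1 * q.2) where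
  add_left _ _ _ := Matrix.add_mul _ _ _
  smul_left _ _ _ := Matrix.smul_mul _ _ _
  add_right _ _ _ := Matrix.mul_add _ _ _
  smul_right _ _ _ := Matrix.mul_smul _ _ _
  bound := ⟨1, one_pos, fun x y => by
    simpa using Matrix.linfty_opNorm_mul x y⟩

/-- Transposition as a continuous linear map. -/
noncomputable def transposeL : Matrix m n ℝ →L[ℝ] Matrix n m ℝ :=
  LinearMap.toContinuousLinearMap (Matrix.transposeLinearEquiv m n ℝ ℝ).toLinearMap

variable {E : Type*} [NormedAddCommGroup E] [NormedSpace ℝ E]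

theorem hasDerivAt_matrix_mul {f : ℝ → Matrix l m ℝ} {g : ℝ → Matrix m n ℝ} {f' g'} {t : ℝ}
    (hf : HasDerivAt f f' t) (hg : HasDerivAt g g' t) :
    HasDerivAt (fun s => f s * g s) (f t * g' + f' * g t) t := by
  have h := (isBoundedBilinearMap_matrix_mul (l := l) (m := m) (n := n)).hasFDerivAt (f t, g t)
  have := h.comp_hasDerivAt t (hf.prodMk hg)
  rw [isBoundedBilinearMap_matrix_mul.deriv_apply] at this
  exact this

theorem hasDerivAt_matrix_transpose {f : ℝ → Matrix l m ℝ} {f'} {t : ℝ}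
    (hf : HasDerivAt f f' t) : HasDerivAt (fun s => (f s)ᵀ) f'ᵀ t :=
  (transposeL (m := l) (n := m)).hasFDerivAt.comp_hasDerivAt t hf

theorem contDiff_matrix_mul {k : WithTop ℕ∞} {f : E → Matrix l m ℝ} {g : E → Matrix m n ℝ}
    (hf : ContDiff ℝ k f) (hg : ContDiff ℝ k g) : ContDiff ℝ k (fun s => f s * g s) :=
  (isBoundedBilinearMap_matrix_mul (l := l) (m := m) (n := n)).contDiff.comp (hf.prodMk hg)

theorem contDiff_matrix_transpose {k : WithTop ℕ∞} {f : E → Matrix l m ℝ}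
    (hf : ContDiff ℝ k f) : ContDiff ℝ k (fun s => (f s)ᵀ) :=
  (transposeL (m := l) (n := m)).contDiff.comp hf

/-- Solutions of an autonomous ODE with a smooth right-hand side are determined by their value
at one time. -/
theorem ode_unique_of_contDiff {F : E → E} (hF : ContDiff ℝ 1 F) {f g : ℝ → E}
    (hf : ∀ t, HasDerivAt f (F (f t)) t) (hg : ∀ t, HasDerivAt g (F (g t)) t) {t₀ : ℝ}
    (h0 : f t₀ = g t₀) : f = g := by
  have hfc : Continuous f := continuous_iff_continuousAt.2 fun t => (hf t).continuousAt
  have hgc : Continuous g := continuous_iff_continuousAt.2 fun t => (hg t).continuousAt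
  have hcl : IsClosed {t | f t = g t} := isClosed_eq hfc hgc
  have hop : IsOpen {t | f t = g t} := by
    rw [isOpen_iff_mem_nhds]
    intro t ht
    obtain ⟨K, s, hs, hl⟩ := (hF.contDiffAt (x := f t)).exists_lipschitzOnWith
    refine ODE_solution_unique_of_eventually (v := fun _ => F) (s := fun _ => s) (K := K)
      (Filter.Eventually.of_forall fun _ => hl) ?_ ?_ ht
    · filter_upwards [hfc.continuousAt hs] with r hr using ⟨hf r, hr⟩
    · have hs' : s ∈ nhds (g t) := by rwa [← show f t = g t from ht]
      filter_upwards [hgc.continuousAt hs'] with r hr using ⟨hg r, hr⟩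
  have := IsClopen.eq_univ ⟨hcl, hop⟩ ⟨t₀, h0⟩
  funext t
  exact (Set.eq_univ_iff_forall.1 this t :)

end Calculus

/-! ### The exponential in a Banach algebra and its derivative -/

section Exponential

variable {𝔸 : Type*} [NormedRing 𝔸] [NormedAlgebra ℝ 𝔸] [CompleteSpace 𝔸]

theorem contDiff_exp {k : WithTop ℕ∞} : ContDiff ℝ k (NormedSpace.exp : 𝔸 → 𝔸) :=
  contDiff_iff_contDiffAt.2 fun x =>
    (NormedSpace.analyticAt_exp_of_mem_ball (𝕂 := ℝ) x
      ((NormedSpace.expSeries_radius_eq_top ℝ 𝔸).symm ▸ edist_lt_top _ _)).contDiffAt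

theorem exp_neg_mul_exp (x : 𝔸) : NormedSpace.exp (-x) * NormedSpace.exp x = 1 := by
  let _ : NormedAlgebra ℚ 𝔸 := NormedAlgebra.restrictScalars ℚ ℝ 𝔸
  rw [← NormedSpace.exp_add_of_commute (Commute.neg_left (Commute.refl x)), neg_add_cancel,
    NormedSpace.exp_zero]

/-- Rodrigues' formula: the right-hand side multiplied by exp(-tx) has zero derivative in t, and
equals 1 at t = 0. -/
theorem exp_smul_of_cube_eq_neg {x : 𝔸} (hx : x * x * x = -x) (t : ℝ) :
    NormedSpace.exp (t • x) = 1 + Real.sin t • x + (1 - Real.cos t) • (x * x) := by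
  have hd : ∀ s : ℝ, HasDerivAt (fun s : ℝ => NormedSpace.exp (s • -x) *
      (1 + Real.sin s • x + (1 - Real.cos s) • (x * x))) 0 s := by
    intro s
    have h1 := hasDerivAt_exp_smul_const (𝕂 := ℝ) (-x) s
    have h2 : HasDerivAt (fun s : ℝ => 1 + Real.sin s • x + (1 - Real.cos s) • (x * x))
        (Real.cos s • x + Real.sin s • (x * x)) s := by
      have := (((Real.hasDerivAt_sin s).smul_const x).const_add (1 : 𝔸)).fun_add
        (((Real.hasDerivAt_cos s).const_sub 1).smul_const (x * x))
      simpa using this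
    convert h1.fun_mul h2 using 1
    simp only [mul_add, mul_one, mul_smul_comm, mul_neg, neg_mul, mul_assoc] at hx ⊢
    simp only [hx, mul_neg, sub_smul, smul_neg, one_smul]
    abel
  have hconst := is_const_of_deriv_eq_zero (fun s => (hd s).differentiableAt)
    (fun s => (hd s).deriv) t 0
  simp only [zero_smul, NormedSpace.exp_zero, Real.sin_zero, Real.cos_zero, sub_self, add_zero,
    mul_one] at hconst
  have := congrArg (fun y => NormedSpace.exp (t • x) * y) hconst
  have hinv := exp_neg_mul_exp (-(t • x))
  rw [neg_neg] at hinv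
  simp only [← mul_assoc, smul_neg, hinv, one_mul, mul_one] at this
  exact this.symm

theorem fderiv_exp_of_commute {x y : 𝔸} (h : Commute x y) :
    fderiv ℝ (NormedSpace.exp : 𝔸 → 𝔸) x y = NormedSpace.exp x * y := by
  let _ : NormedAlgebra ℚ 𝔸 := NormedAlgebra.restrictScalars ℚ ℝ 𝔸
  have hexp := (contDiff_exp (𝔸 := 𝔸) (k := 1)).differentiable one_ne_zero
  have h1 : HasDerivAt (fun s : ℝ => NormedSpace.exp (x + s • y))
      (fderiv ℝ (NormedSpace.exp : 𝔸 → 𝔸) x y) 0 := by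
    have hl : HasDerivAt (fun s : ℝ => x + s • y) y 0 := by
      simpa using ((hasDerivAt_id (0 : ℝ)).smul_const y).const_add x
    have := (hexp (x + (0 : ℝ) • y)).hasFDerivAt.comp_hasDerivAt 0 hl
    simpa [Function.comp_def] using this
  have h2 : HasDerivAt (fun s : ℝ => NormedSpace.exp (x + s • y)) (NormedSpace.exp x * y) 0 := by
    have := (hasDerivAt_exp_smul_const (𝕂 := ℝ) y 0).const_mul (NormedSpace.exp x)
    simp only [zero_smul, NormedSpace.exp_zero, one_mul] at this
    refine this.congr_of_eventuallyEq (Filter.Eventually.of_forall fun s => ?_)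
    exact NormedSpace.exp_add_of_commute (h.smul_right s)
  exact h1.unique h2

/-- The derivative of the exponential along the infinitesimal conjugation `xy - yx`. -/
theorem fderiv_exp_commutator (x y : 𝔸) :
    fderiv ℝ (NormedSpace.exp : 𝔸 → 𝔸) x (x * y - y * x) =
      NormedSpace.exp x * y - y * NormedSpace.exp x := by
  let _ : NormedAlgebra ℚ 𝔸 := NormedAlgebra.restrictScalars ℚ ℝ 𝔸
  have hexp := (contDiff_exp (𝔸 := 𝔸) (k := 1)).differentiable one_ne_zero
  have hconj (z : 𝔸) : HasDerivAt (fun s : ℝ => NormedSpace.exp (s • -y) * z *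
      NormedSpace.exp (s • y)) (z * y - y * z) 0 := by
    have h1 := hasDerivAt_exp_smul_const (𝕂 := ℝ) (-y) 0
    have h2 := hasDerivAt_exp_smul_const (𝕂 := ℝ) y 0
    have := (h1.mul_const z).fun_mul h2
    simpa [sub_eq_add_neg, add_comm] using this
  -- The exponential commutes with conjugation by exp(sy); both sides of that identity are
  -- differentiated at s = 0.
  have h1 : HasDerivAt (fun s : ℝ => NormedSpace.exp (NormedSpace.exp (s • -y) * x *
      NormedSpace.exp (s • y))) (fderiv ℝ (NormedSpace.exp : 𝔸 → 𝔸) x (x * y - y * x)) 0 := by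
    have := (hexp (NormedSpace.exp ((0 : ℝ) • -y) * x *
      NormedSpace.exp ((0 : ℝ) • y))).hasFDerivAt.comp_hasDerivAt 0 (hconj x)
    simpa [Function.comp_def] using this
  refine h1.unique ((hconj (NormedSpace.exp x)).congr_of_eventuallyEq
    (Filter.Eventually.of_forall fun s => ?_))
  have hi := exp_neg_mul_exp (s • y)
  have hi' := exp_neg_mul_exp (-(s • y))
  rw [neg_neg] at hi'
  have := NormedSpace.exp_units_conj ⟨NormedSpace.exp (-(s • y)), NormedSpace.exp (s • y), hi, hi'⟩ x
  simpa using this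

end Exponential

/-! ### Geodesics as solutions of a second-order ODE -/

section GeodesicEquation

variable {n p : ℕ} {β : ℝ}

theorem metric_eq (β : ℝ) (X ξ η : Matrix (Fin n) (Fin p) ℝ) :
    metric β X ξ η = (ξᵀ * η).trace + (β - 1) * (ξᵀ * (X * Xᵀ) * η).trace := by
  simp only [metric, Matrix.transpose_mul, Matrix.transpose_transpose, Matrix.mul_sub,
    Matrix.sub_mul, Matrix.mul_one, Matrix.trace_sub, Matrix.mul_assoc]
  ring

theorem fderiv_metric (β : ℝ) (X u v w : Matrix (Fin n) (Fin p) ℝ) :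
    fderiv ℝ (fun Y => metric β Y v w) X u = (β - 1) * (vᵀ * (X * uᵀ + u * Xᵀ) * w).trace := by
  let φ : Matrix (Fin n) (Fin n) ℝ →ₗ[ℝ] ℝ :=
    { toFun := fun Z => (vᵀ * Z * w).trace
      map_add' := by intros; simp [Matrix.mul_add, Matrix.add_mul]
      map_smul' := by intros; simp }
  have hφ : Differentiable ℝ (fun Z => φ Z) := (LinearMap.toContinuousLinearMap φ).differentiable
  have hX : ContDiff ℝ 1 fun Y : Matrix (Fin n) (Fin p) ℝ => Y * Yᵀ :=
    contDiff_matrix_mul contDiff_id (contDiff_matrix_transpose contDiff_id)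
  have hd : DifferentiableAt ℝ (fun Y => metric β Y v w) X := by
    have h : (fun Y => metric β Y v w) = fun Y => (vᵀ * w).trace + (β - 1) * φ (Y * Yᵀ) :=
      funext fun Y => metric_eq β Y v w
    rw [h]
    exact (((hφ.comp (hX.differentiable one_ne_zero)).const_mul _).const_add _) X
  have hl : HasDerivAt (fun s : ℝ => X + s • u) u 0 := by
    have := ((hasDerivAt_id (0 : ℝ)).smul_const u).const_add X
    rw [one_smul] at this
    exact this
  have h1 : HasDerivAt (fun s : ℝ => metric β (X + s • u) v w)
      (fderiv ℝ (fun Y => metric β Y v w) X u) 0 := by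
    have hd' : HasFDerivAt (fun Y => metric β Y v w) (fderiv ℝ (fun Y => metric β Y v w) X)
      (X + (0 : ℝ) • u) := by simpa using hd.hasFDerivAt
    exact hd'.comp_hasDerivAt 0 hl
  have h2 : HasDerivAt (fun s : ℝ => metric β (X + s • u) v w)
      ((β - 1) * φ (X * uᵀ + u * Xᵀ)) 0 := by
    have h := hasDerivAt_matrix_mul hl (hasDerivAt_matrix_transpose hl)
    have h' := (((LinearMap.toContinuousLinearMap φ).hasFDerivAt.comp_hasDerivAt 0 h).const_mul
      (β - 1)).const_add (vᵀ * w).trace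
    have e : (fun s : ℝ => metric β (X + s • u) v w) = fun s => (vᵀ * w).trace +
        (β - 1) * φ ((X + s • u) * (X + s • u)ᵀ) := funext fun s => metric_eq β _ v w
    rw [e]
    simp only [zero_smul, add_zero] at h'
    exact h'
  exact h1.unique h2

/-- The acceleration of a geodesic of `St_β(n, p)` at `X` with velocity `v`. -/
def accel (β : ℝ) (X v : Matrix (Fin n) (Fin p) ℝ) : Matrix (Fin n) (Fin p) ℝ :=
  X * ((2 * (β - 1)) • (Xᵀ * v * (Xᵀ * v)) - vᵀ * v) - (2 * (β - 1)) • (v * (Xᵀ * v))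

theorem mem_tangent_iff {X ξ : Matrix (Fin n) (Fin p) ℝ} :
    ξ ∈ tangent X ↔ ξᵀ * X = -(Xᵀ * ξ) := by
  rw [eq_neg_iff_add_eq_zero, add_comm]
  rfl

theorem transpose_of_mem_tangent {X ξ : Matrix (Fin n) (Fin p) ℝ} (h : ξ ∈ tangent X) :
    (Xᵀ * ξ)ᵀ = -(Xᵀ * ξ) := by
  rw [Matrix.transpose_mul, Matrix.transpose_transpose, mem_tangent_iff.1 h]

/-- Makes `accel` compatible with the constraint `Xᵀ * X = 1` differentiated twice. -/
theorem transpose_mul_accel {X v : Matrix (Fin n) (Fin p) ℝ} (hX : X ∈ stiefel n p) :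
    Xᵀ * accel β X v = -(vᵀ * v) := by
  have hX' : Xᵀ * X = 1 := hX
  simp only [accel, Matrix.mul_sub, ← Matrix.mul_assoc, hX', Matrix.one_mul, Matrix.mul_smul]
  abel

theorem accel_transpose_mul {X v : Matrix (Fin n) (Fin p) ℝ} (hX : X ∈ stiefel n p) :
    (accel β X v)ᵀ * X = -(vᵀ * v) := by
  have := congrArg Matrix.transpose (transpose_mul_accel (β := β) (v := v) hX)
  simpa using this

theorem trace_mul_eq_zero_of_symm_of_skew {S K : Matrix (Fin p) (Fin p) ℝ} (hS : Sᵀ = S)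
    (hK : Kᵀ = -K) : (S * K).trace = 0 := by
  have h := Matrix.trace_transpose (S * K)
  rw [Matrix.transpose_mul, hS, hK, Matrix.neg_mul, Matrix.trace_neg, Matrix.trace_mul_comm] at h
  linarith

theorem christoffel_metric {X v η : Matrix (Fin n) (Fin p) ℝ} (hv : v ∈ tangent X)
    (hη : η ∈ tangent X) :
    christoffel (metric β) X v v η = -(2 * (β - 1)) * (Xᵀ * v * (vᵀ * η)).trace := by
  have hvX := mem_tangent_iff.1 hv
  have hK := transpose_of_mem_tangent hη
  have h0 : (vᵀ * v * (Xᵀ * η)).trace = 0 :=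
    trace_mul_eq_zero_of_symm_of_skew (by simp) hK
  have h1 : (vᵀ * (X * vᵀ + v * Xᵀ) * η).trace = -(Xᵀ * v * (vᵀ * η)).trace := by
    have : vᵀ * (X * vᵀ + v * Xᵀ) * η = (vᵀ * X) * (vᵀ * η) + vᵀ * v * (Xᵀ * η) := by
      simp only [Matrix.mul_add, Matrix.add_mul, Matrix.mul_assoc]
    rw [this, Matrix.trace_add, h0, hvX, Matrix.neg_mul, Matrix.trace_neg, add_zero]
  have h2 : (vᵀ * (X * ηᵀ + η * Xᵀ) * v).trace = 2 * (Xᵀ * v * (vᵀ * η)).trace := by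
    have e : vᵀ * (X * ηᵀ + η * Xᵀ) * v = (vᵀ * X) * (ηᵀ * v) + vᵀ * η * (Xᵀ * v) := by
      simp only [Matrix.mul_add, Matrix.add_mul, Matrix.mul_assoc]
    have e2 : (vᵀ * X * (ηᵀ * v)).trace = (vᵀ * η * (Xᵀ * v)).trace := by
      rw [← Matrix.trace_transpose]
      simp
    rw [e, Matrix.trace_add, e2, Matrix.trace_mul_comm]
    ring
  have e1 := fderiv_metric β X v v η
  have e2 := fderiv_metric β X η v v
  rw [h1] at e1
  rw [h2] at e2
  refine (congrArg₂ (fun a b => 1 / 2 * (a + a - b)) e1 e2).trans ?_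
  ring

/-- A symmetric matrix times a skew one has trace zero, which removes all terms but the multiples of
tr(Xᵀv vᵀη); these cancel. -/
theorem metric_accel_add_christoffel {X v η : Matrix (Fin n) (Fin p) ℝ} (hX : X ∈ stiefel n p)
    (hv : v ∈ tangent X) (hη : η ∈ tangent X) :
    metric β X (accel β X v) η + christoffel (metric β) X v v η = 0 := by
  have hA := transpose_of_mem_tangent hv
  have hK := transpose_of_mem_tangent hη
  have hW : (vᵀ * v * (Xᵀ * η)).trace = 0 :=
    trace_mul_eq_zero_of_symm_of_skew (by simp) hK
  have hAA : (Xᵀ * v * (Xᵀ * v) * (Xᵀ * η)).trace = 0 :=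
    trace_mul_eq_zero_of_symm_of_skew (by rw [Matrix.transpose_mul, hA]; simp) hK
  have h1 : ((accel β X v)ᵀ * η).trace = 2 * (β - 1) * (Xᵀ * v * (vᵀ * η)).trace := by
    have e : (accel β X v)ᵀ * η = (2 * (β - 1)) • (Xᵀ * v * (Xᵀ * v) * (Xᵀ * η))
        - vᵀ * v * (Xᵀ * η) + (2 * (β - 1)) • (Xᵀ * v * (vᵀ * η)) := by
      have ht : (accel β X v)ᵀ = ((2 * (β - 1)) • (Xᵀ * v * (Xᵀ * v)) - vᵀ * v) * Xᵀ
          + (2 * (β - 1)) • ((Xᵀ * v) * vᵀ) := by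
        rw [accel, Matrix.transpose_sub, Matrix.transpose_mul, Matrix.transpose_sub,
          Matrix.transpose_smul, Matrix.transpose_smul, Matrix.transpose_mul (Xᵀ * v),
          Matrix.transpose_mul v, hA, Matrix.transpose_mul vᵀ v, Matrix.transpose_transpose]
        simp
      rw [ht]
      simp only [Matrix.add_mul, Matrix.sub_mul, Matrix.smul_mul, Matrix.mul_assoc]
    rw [e]
    simp only [Matrix.trace_add, Matrix.trace_sub, Matrix.trace_smul, hW, hAA, smul_eq_mul]
    ring
  have h2 : ((accel β X v)ᵀ * (X * Xᵀ) * η).trace = 0 := by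
    have e : (accel β X v)ᵀ * (X * Xᵀ) * η = -(vᵀ * v * (Xᵀ * η)) := by
      rw [← Matrix.mul_assoc, accel_transpose_mul hX, Matrix.mul_assoc, Matrix.neg_mul]
    rw [e, Matrix.trace_neg, hW, neg_zero]
  rw [christoffel_metric hv hη, metric_eq, h1, h2]
  ring

theorem eq_zero_of_metric_self_eq_zero (hβ : 0 < β) {X ξ : Matrix (Fin n) (Fin p) ℝ}
    (hX : X ∈ stiefel n p) (h : metric β X ξ ξ = 0) : ξ = 0 := by
  have hX' : Xᵀ * X = 1 := hX
  have nonneg (m : ℕ) (Z : Matrix (Fin m) (Fin p) ℝ) : 0 ≤ (Zᵀ * Z).trace := by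
    simpa using (Matrix.posSemidef_conjTranspose_mul_self Z).trace_nonneg
  have zero (m : ℕ) (Z : Matrix (Fin m) (Fin p) ℝ) (hZ : (Zᵀ * Z).trace = 0) : Z = 0 := by
    refine Matrix.trace_conjTranspose_mul_self_eq_zero_iff.1 ?_
    simpa using hZ
  -- `1 - X * Xᵀ` is an orthogonal projection, so the metric is a positive combination of two
  -- squared Frobenius norms.
  have e : ξᵀ * (1 - X * Xᵀ) * ξ = (ξ - X * (Xᵀ * ξ))ᵀ * (ξ - X * (Xᵀ * ξ)) := by
    have e1 : Xᵀ * (ξ - X * (Xᵀ * ξ)) = 0 := by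
      rw [Matrix.mul_sub, ← Matrix.mul_assoc, hX', Matrix.one_mul, sub_self]
    rw [Matrix.transpose_sub, Matrix.sub_mul, Matrix.transpose_mul, Matrix.mul_assoc _ Xᵀ, e1,
      Matrix.mul_zero, sub_zero, Matrix.mul_assoc, Matrix.sub_mul, Matrix.one_mul,
      Matrix.mul_assoc]
  rw [metric, e] at h
  have h1 := nonneg _ (Xᵀ * ξ)
  have h2 := nonneg _ (ξ - X * (Xᵀ * ξ))
  have h3 : 0 ≤ β * ((Xᵀ * ξ)ᵀ * (Xᵀ * ξ)).trace := by positivity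
  have h4 : (Xᵀ * ξ) = 0 := by
    refine zero _ _ ((mul_eq_zero.1 ?_).resolve_left hβ.ne')
    linarith
  have h5 := zero _ (ξ - X * (Xᵀ * ξ)) (by linarith)
  rwa [h4, Matrix.mul_zero, sub_zero] at h5

theorem metric_sub_left (X ξ ζ η : Matrix (Fin n) (Fin p) ℝ) :
    metric β X (ξ - ζ) η = metric β X ξ η - metric β X ζ η := by
  simp only [metric_eq, Matrix.transpose_sub, Matrix.sub_mul, Matrix.trace_sub]
  ring

/-- Both accelerations satisfy the twice differentiated constraint `ha`, so their difference is
tangent. It is also orthogonal to all tangent vectors, in particular to itself. -/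
theorem eq_accel_of_pairing (hβ : 0 < β) {X v a : Matrix (Fin n) (Fin p) ℝ} (hX : X ∈ stiefel n p)
    (hv : v ∈ tangent X) (ha : Xᵀ * a + vᵀ * v + (vᵀ * v + aᵀ * X) = 0)
    (h : ∀ η ∈ tangent X, metric β X a η + christoffel (metric β) X v v η = 0) :
    a = accel β X v := by
  have hd : a - accel β X v ∈ tangent X := by
    change Xᵀ * (a - accel β X v) + (a - accel β X v)ᵀ * X = 0
    rw [Matrix.mul_sub, Matrix.transpose_sub, Matrix.sub_mul, transpose_mul_accel hX,
      accel_transpose_mul hX, ← ha]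
    abel
  refine sub_eq_zero.1 (eq_zero_of_metric_self_eq_zero hβ hX ?_)
  rw [metric_sub_left]
  linarith [h _ hd, metric_accel_add_christoffel (β := β) hX hv hd]

theorem mem_tangent_of_hasDerivAt {γ : ℝ → Matrix (Fin n) (Fin p) ℝ} (hγ : ∀ t, γ t ∈ stiefel n p)
    {t : ℝ} {v : Matrix (Fin n) (Fin p) ℝ} (h : HasDerivAt γ v t) : v ∈ tangent (γ t) := by
  have h1 := hasDerivAt_matrix_mul (hasDerivAt_matrix_transpose h) h
  have h2 : (fun s => (γ s)ᵀ * γ s) = fun _ => 1 := funext hγ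
  rw [h2] at h1
  exact h1.unique (hasDerivAt_const t _)

theorem contDiff_accel : ContDiff ℝ 1 fun q : Matrix (Fin n) (Fin p) ℝ × Matrix (Fin n) (Fin p) ℝ =>
    accel β q.1 q.2 := by
  have hA : ContDiff ℝ 1 fun q : Matrix (Fin n) (Fin p) ℝ × Matrix (Fin n) (Fin p) ℝ =>
    q.1ᵀ * q.2 := contDiff_matrix_mul (contDiff_matrix_transpose contDiff_fst) contDiff_snd
  exact (contDiff_matrix_mul contDiff_fst
    (((contDiff_matrix_mul hA hA).const_smul _).sub
      (contDiff_matrix_mul (contDiff_matrix_transpose contDiff_snd) contDiff_snd))).sub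
    ((contDiff_matrix_mul contDiff_snd hA).const_smul _)

theorem IsGeodesic.hasDerivAt {γ : ℝ → Matrix (Fin n) (Fin p) ℝ}
    (h : IsGeodesic (metric β) (stiefel n p) tangent γ) (t : ℝ) : HasDerivAt γ (deriv γ t) t :=
  (h.smooth.differentiable (by simp) t).hasDerivAt

theorem IsGeodesic.hasDerivAt_deriv (hβ : 0 < β) {γ : ℝ → Matrix (Fin n) (Fin p) ℝ}
    (h : IsGeodesic (metric β) (stiefel n p) tangent γ) (t : ℝ) :
    HasDerivAt (deriv γ) (accel β (γ t) (deriv γ t)) t := by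
  have h1 := h.hasDerivAt
  have h2 : HasDerivAt (deriv γ) (deriv (deriv γ) t) t :=
    ((h.smooth.iterate_deriv 1).differentiable (by simp) t).hasDerivAt
  have htan := fun s => mem_tangent_of_hasDerivAt h.mem (h1 s)
  have hc : (γ t)ᵀ * deriv (deriv γ) t + (deriv γ t)ᵀ * deriv γ t +
      ((deriv γ t)ᵀ * deriv γ t + (deriv (deriv γ) t)ᵀ * γ t) = 0 := by
    have h3 := (hasDerivAt_matrix_mul (hasDerivAt_matrix_transpose (h1 t)) h2).fun_add
      (hasDerivAt_matrix_mul (hasDerivAt_matrix_transpose h2) (h1 t))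
    have h4 : (fun s => (γ s)ᵀ * deriv γ s + (deriv γ s)ᵀ * γ s) = fun _ => 0 := funext htan
    rw [h4] at h3
    exact h3.unique (hasDerivAt_const t _)
  have := eq_accel_of_pairing hβ (h.mem t) (htan t) hc (h.geodesic_eq t)
  exact this ▸ h2

theorem isGeodesic_of_hasDerivAt {γ γ' : ℝ → Matrix (Fin n) (Fin p) ℝ} (hs : ContDiff ℝ ∞ γ)
    (hm : ∀ t, γ t ∈ stiefel n p) (h1 : ∀ t, HasDerivAt γ (γ' t) t)
    (h2 : ∀ t, HasDerivAt γ' (accel β (γ t) (γ' t)) t) :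
    IsGeodesic (metric β) (stiefel n p) tangent γ := by
  have e1 : deriv γ = γ' := funext fun t => (h1 t).deriv
  refine ⟨hs, hm, fun t η hη => ?_⟩
  have e2 : deriv γ' t = accel β (γ t) (γ' t) := (h2 t).deriv
  have := metric_accel_add_christoffel (β := β) (hm t) (mem_tangent_of_hasDerivAt hm (h1 t)) hη
  rw [← e2, ← e1] at this
  exact this

/-- The pair (γ, γ') solves a smooth first-order autonomous system. -/
theorem IsGeodesic.unique (hβ : 0 < β) {γ δ : ℝ → Matrix (Fin n) (Fin p) ℝ}
    (hγ : IsGeodesic (metric β) (stiefel n p) tangent γ)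
    (hδ : IsGeodesic (metric β) (stiefel n p) tangent δ) (h0 : γ 0 = δ 0)
    (h1 : deriv γ 0 = deriv δ 0) : γ = δ := by
  have hF : ContDiff ℝ 1 fun q : Matrix (Fin n) (Fin p) ℝ × Matrix (Fin n) (Fin p) ℝ =>
      (q.2, accel β q.1 q.2) := contDiff_snd.prodMk contDiff_accel
  have := ode_unique_of_contDiff hF (f := fun t => (γ t, deriv γ t))
    (g := fun t => (δ t, deriv δ t)) (t₀ := 0)
    (fun t => (hγ.hasDerivAt t).prodMk (hγ.hasDerivAt_deriv hβ t))
    (fun t => (hδ.hasDerivAt t).prodMk (hδ.hasDerivAt_deriv hβ t)) (Prod.ext h0 h1)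
  funext t
  exact congrArg Prod.fst (congrFun this t)

end GeodesicEquation

/-! ### Block matrix algebra -/

section Blocks

variable {n p : ℕ} (h : p ≤ n)

/-- The block matrix `[A, B; C, D]`. -/
def block (A : Matrix (Fin p) (Fin p) ℝ) (B : Matrix (Fin p) (Fin (n - p)) ℝ)
    (C : Matrix (Fin (n - p)) (Fin p) ℝ) (D : Matrix (Fin (n - p)) (Fin (n - p)) ℝ) :
    Matrix (Fin n) (Fin n) ℝ :=
  Matrix.reindex (split h) (split h) (Matrix.fromBlocks A B C D)

theorem omega_eq_block (β : ℝ) (A : Matrix (Fin p) (Fin p) ℝ)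
    (H : Matrix (Fin (n - p)) (Fin p) ℝ) : omega h β A H = block h ((2 * β) • A) (-Hᵀ) H 0 :=
  rfl

theorem block_mul_stack (A B C D) (X : Matrix (Fin p) (Fin p) ℝ)
    (Y : Matrix (Fin (n - p)) (Fin p) ℝ) :
    block h A B C D * stack h X Y = stack h (A * X + B * Y) (C * X + D * Y) := by
  simp only [block, stack, Matrix.reindex_apply, Matrix.submatrix_mul_equiv,
    Matrix.fromBlocks_mul_fromRows]

theorem block_mul_block (A B C D A' B' C' D') :
    block h A B C D * block h A' B' C' D' =
      block h (A * A' + B * C') (A * B' + B * D') (C * A' + D * C') (C * B' + D * D') := by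
  simp only [block, Matrix.reindex_apply, Matrix.submatrix_mul_equiv, Matrix.fromBlocks_multiply]

theorem block_add_block (A B C D A' B' C' D') :
    block h A B C D + block h A' B' C' D' =
      block h (A + A') (B + B') (C + C') (D + D') := by
  rw [block, block, block, ← Matrix.fromBlocks_add]
  rfl

theorem smul_block (c : ℝ) (A B C D) :
    c • block h A B C D = block h (c • A) (c • B) (c • C) (c • D) := by
  rw [block, block, ← Matrix.fromBlocks_smul]
  rfl

theorem neg_block (A B C D) : -block h A B C D = block h (-A) (-B) (-C) (-D) := by
  rw [block, block, ← Matrix.fromBlocks_neg]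
  rfl

theorem transpose_block (A B C D) : (block h A B C D)ᵀ = block h Aᵀ Cᵀ Bᵀ Dᵀ := by
  rw [block, block, ← Matrix.fromBlocks_transpose]
  rfl

theorem stack_mul (A : Matrix (Fin p) (Fin p) ℝ) (H : Matrix (Fin (n - p)) (Fin p) ℝ)
    (E : Matrix (Fin p) (Fin p) ℝ) : stack h A H * E = stack h (A * E) (H * E) := by
  rw [stack, stack, ← Matrix.fromRows_mul]
  rfl

theorem stack_add_stack (A A' : Matrix (Fin p) (Fin p) ℝ) (H H' : Matrix (Fin (n - p)) (Fin p) ℝ) :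
    stack h A H + stack h A' H' = stack h (A + A') (H + H') := by
  ext i j
  rcases hi : (split h).symm i with k | k <;> simp [stack, hi]

theorem stack_sub_stack (A A' : Matrix (Fin p) (Fin p) ℝ) (H H' : Matrix (Fin (n - p)) (Fin p) ℝ) :
    stack h A H - stack h A' H' = stack h (A - A') (H - H') := by
  ext i j
  rcases hi : (split h).symm i with k | k <;> simp [stack, hi]

theorem smul_stack (c : ℝ) (A : Matrix (Fin p) (Fin p) ℝ) (H : Matrix (Fin (n - p)) (Fin p) ℝ) :
    c • stack h A H = stack h (c • A) (c • H) := by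
  ext i j
  rcases hi : (split h).symm i with k | k <;> simp [stack, hi]

theorem stack_zero : stack h 0 0 = 0 := by
  simpa using (smul_stack h (0 : ℝ) 0 0).symm

theorem transpose_stack_mul_stack (A B : Matrix (Fin p) (Fin p) ℝ)
    (H K : Matrix (Fin (n - p)) (Fin p) ℝ) : (stack h A H)ᵀ * stack h B K = Aᵀ * B + Hᵀ * K := by
  rw [stack, stack, Matrix.reindex_apply, Matrix.reindex_apply, Matrix.transpose_submatrix,
    Matrix.submatrix_mul_equiv, Matrix.transpose_fromRows, Matrix.fromCols_mul_fromRows]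
  ext i j
  simp

/-- The upper block of an `n × p` matrix. -/
def upper (Z : Matrix (Fin n) (Fin p) ℝ) : Matrix (Fin p) (Fin p) ℝ :=
  Z.submatrix (split h ∘ Sum.inl) id

/-- The lower block of an `n × p` matrix. -/
def lower (Z : Matrix (Fin n) (Fin p) ℝ) : Matrix (Fin (n - p)) (Fin p) ℝ :=
  Z.submatrix (split h ∘ Sum.inr) id

theorem stack_upper_lower (Z : Matrix (Fin n) (Fin p) ℝ) : stack h (upper h Z) (lower h Z) = Z := by
  ext i j
  obtain ⟨i, rfl⟩ := (split h).surjective i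
  rcases i with k | k <;> simp [stack, upper, lower]

@[simp]
theorem upper_stack (A : Matrix (Fin p) (Fin p) ℝ) (H : Matrix (Fin (n - p)) (Fin p) ℝ) :
    upper h (stack h A H) = A := by
  ext i j
  simp [stack, upper]

@[simp]
theorem lower_stack (A : Matrix (Fin p) (Fin p) ℝ) (H : Matrix (Fin (n - p)) (Fin p) ℝ) :
    lower h (stack h A H) = H := by
  ext i j
  simp [stack, lower]

theorem transpose_omega {β : ℝ} {A : Matrix (Fin p) (Fin p) ℝ} (hA : Aᵀ = -A)
    (H : Matrix (Fin (n - p)) (Fin p) ℝ) : (omega h β A H)ᵀ = -omega h β A H := by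
  rw [omega_eq_block, transpose_block, neg_block, Matrix.transpose_smul, hA]
  simp

theorem smul_omega (c β : ℝ) (A : Matrix (Fin p) (Fin p) ℝ)
    (H : Matrix (Fin (n - p)) (Fin p) ℝ) : c • omega h β A H = omega h β (c • A) (c • H) := by
  rw [omega_eq_block, omega_eq_block, smul_block, smul_comm c]
  simp

theorem omega_add (β : ℝ) (A B : Matrix (Fin p) (Fin p) ℝ)
    (H K : Matrix (Fin (n - p)) (Fin p) ℝ) :
    omega h β A H + omega h β B K = omega h β (A + B) (H + K) := by
  simp only [omega_eq_block, block_add_block, smul_add, Matrix.transpose_add, neg_add, add_zero]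

end Blocks

/-! ### Closed form of geodesics and of the exponential map -/

section Geodesics

variable {n p : ℕ} (h : p ≤ n) {β : ℝ} {Q : Matrix (Fin n) (Fin n) ℝ}

theorem transpose_exp_mul_exp {m : ℕ} {S : Matrix (Fin m) (Fin m) ℝ} (hS : Sᵀ = -S) :
    (NormedSpace.exp S)ᵀ * NormedSpace.exp S = 1 := by
  rw [← Matrix.exp_transpose, hS]
  exact exp_neg_mul_exp S

theorem transpose_smul_skew {m : ℕ} {S : Matrix (Fin m) (Fin m) ℝ} (hS : Sᵀ = -S) (c : ℝ) :
    (c • S)ᵀ = -(c • S) := by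
  rw [Matrix.transpose_smul, hS, smul_neg]

theorem transpose_mul_self_of_mem (hQ : Q ∈ Matrix.orthogonalGroup (Fin n) ℝ) : Qᵀ * Q = 1 := by
  have := (Matrix.mem_orthogonalGroup_iff' (Fin n) ℝ).1 hQ
  simpa [Matrix.star_eq_conjTranspose] using this

theorem mul_exp_mem_orthogonalGroup (hQ : Q ∈ Matrix.orthogonalGroup (Fin n) ℝ)
    {S : Matrix (Fin n) (Fin n) ℝ} (hS : Sᵀ = -S) :
    Q * NormedSpace.exp S ∈ Matrix.orthogonalGroup (Fin n) ℝ := by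
  refine mul_mem hQ ((Matrix.mem_orthogonalGroup_iff' (Fin n) ℝ).2 ?_)
  simpa [Matrix.star_eq_conjTranspose] using transpose_exp_mul_exp hS

theorem transpose_mul_stack_mul_stack (hQ : Q ∈ Matrix.orthogonalGroup (Fin n) ℝ)
    (A B : Matrix (Fin p) (Fin p) ℝ) (H K : Matrix (Fin (n - p)) (Fin p) ℝ) :
    (Q * stack h A H)ᵀ * (Q * stack h B K) = Aᵀ * B + Hᵀ * K := by
  rw [Matrix.transpose_mul, Matrix.mul_assoc, ← Matrix.mul_assoc Qᵀ,
    transpose_mul_self_of_mem hQ, Matrix.one_mul, transpose_stack_mul_stack]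

theorem mul_frame_mem_stiefel (hQ : Q ∈ Matrix.orthogonalGroup (Fin n) ℝ) :
    Q * frame h ∈ stiefel n p := by
  change (Q * frame h)ᵀ * (Q * frame h) = 1
  rw [frame, transpose_mul_stack_mul_stack h hQ]
  simp

theorem mul_stack_mem_tangent_iff (hQ : Q ∈ Matrix.orthogonalGroup (Fin n) ℝ)
    {A : Matrix (Fin p) (Fin p) ℝ} {H : Matrix (Fin (n - p)) (Fin p) ℝ} :
    Q * stack h A H ∈ tangent (Q * frame h) ↔ Aᵀ = -A := by
  rw [mem_tangent_iff, frame, transpose_mul_stack_mul_stack h hQ,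
    transpose_mul_stack_mul_stack h hQ]
  simp

/-- The geodesic of `St_β(n, p)` starting at `Q I_{n×p}` in the direction `Q [A; H]`. -/
noncomputable def geodesic (β : ℝ) (Q : Matrix (Fin n) (Fin n) ℝ) (A : Matrix (Fin p) (Fin p) ℝ)
    (H : Matrix (Fin (n - p)) (Fin p) ℝ) (t : ℝ) : Matrix (Fin n) (Fin p) ℝ :=
  Q * NormedSpace.exp (t • omega h β A H) * frame h * NormedSpace.exp (t • ((1 - 2 * β) • A))

theorem hasDerivAt_mul_exp_mul_exp (Q Ω : Matrix (Fin n) (Fin n) ℝ) (Z : Matrix (Fin n) (Fin p) ℝ)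
    (B : Matrix (Fin p) (Fin p) ℝ) (t : ℝ) :
    HasDerivAt (fun t : ℝ => Q * NormedSpace.exp (t • Ω) * Z * NormedSpace.exp (t • B))
      (Q * NormedSpace.exp (t • Ω) * (Ω * Z + Z * B) * NormedSpace.exp (t • B)) t := by
  have h1 := hasDerivAt_exp_smul_const (𝕂 := ℝ) Ω t
  have h2 := hasDerivAt_exp_smul_const' (𝕂 := ℝ) B t
  have h3 := hasDerivAt_matrix_mul (hasDerivAt_matrix_mul
    (hasDerivAt_matrix_mul (hasDerivAt_const t Q) h1) (hasDerivAt_const t Z)) h2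
  refine h3.congr_deriv ?_
  simp only [Matrix.mul_zero, Matrix.zero_mul, add_zero, zero_add, Matrix.mul_add, Matrix.add_mul,
    Matrix.mul_assoc]
  exact add_comm _ _

theorem hasDerivAt_geodesic (A : Matrix (Fin p) (Fin p) ℝ) (H : Matrix (Fin (n - p)) (Fin p) ℝ)
    (t : ℝ) : HasDerivAt (geodesic h β Q A H)
      (Q * NormedSpace.exp (t • omega h β A H) * stack h A H *
        NormedSpace.exp (t • ((1 - 2 * β) • A))) t := by
  have e : omega h β A H * frame h + frame h * ((1 - 2 * β) • A) = stack h A H := by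
    rw [omega_eq_block, frame, block_mul_stack, stack_mul, stack_add_stack]
    congr 1
    · simp only [Matrix.mul_one, Matrix.mul_zero, add_zero, Matrix.one_mul, ← add_smul]
      simp
    · simp
  rw [← e]
  exact hasDerivAt_mul_exp_mul_exp Q (omega h β A H) (frame h) ((1 - 2 * β) • A) t

/-- The right-hand side is the second derivative of the closed form, with Q exp(tΩ) in the role of
`Q` and exp(t(1 - 2β)A) in that of `E`. The latter is orthogonal and commutes with `A`, so it can be
moved to the far right. -/
theorem accel_mul_stack (hQ : Q ∈ Matrix.orthogonalGroup (Fin n) ℝ)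
    {A E : Matrix (Fin p) (Fin p) ℝ} (hA : Aᵀ = -A) (hE : Eᵀ * E = 1) (hAE : E * A = A * E)
    (H : Matrix (Fin (n - p)) (Fin p) ℝ) :
    accel β (Q * frame h * E) (Q * stack h A H * E) =
      Q * (omega h β A H * stack h A H + stack h A H * ((1 - 2 * β) • A)) * E := by
  have hE' : E * Eᵀ = 1 := mul_eq_one_comm.1 hE
  have e1 : (Q * frame h * E)ᵀ * (Q * stack h A H * E) = A := by
    rw [Matrix.transpose_mul, Matrix.mul_assoc, ← Matrix.mul_assoc _ _ E, frame,
      transpose_mul_stack_mul_stack h hQ]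
    simp only [Matrix.transpose_one, Matrix.one_mul, Matrix.transpose_zero, Matrix.zero_mul,
      add_zero]
    rw [← hAE, ← Matrix.mul_assoc, hE, Matrix.one_mul]
  have e2 : (Q * stack h A H * E)ᵀ * (Q * stack h A H * E) = Eᵀ * (Hᵀ * H - A * A) * E := by
    rw [Matrix.transpose_mul, Matrix.mul_assoc, ← Matrix.mul_assoc _ _ E,
      transpose_mul_stack_mul_stack h hQ, hA, Matrix.mul_assoc]
    simp only [Matrix.neg_mul, neg_add_eq_sub]
  have e3 : E * (Eᵀ * (Hᵀ * H - A * A) * E) = (Hᵀ * H - A * A) * E := by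
    rw [← Matrix.mul_assoc, ← Matrix.mul_assoc, hE', Matrix.one_mul]
  have e4 : E * (A * A) = A * A * E := by
    rw [← Matrix.mul_assoc, hAE, Matrix.mul_assoc, hAE, Matrix.mul_assoc]
  rw [accel, e1, e2, Matrix.mul_sub, Matrix.mul_smul, Matrix.mul_assoc _ E, e4,
    Matrix.mul_assoc _ E, e3, Matrix.mul_assoc _ E, hAE, omega_eq_block, block_mul_stack,
    stack_mul, stack_add_stack, frame]
  simp only [Matrix.mul_assoc Q, stack_mul, ← Matrix.mul_smul, ← Matrix.mul_sub, smul_stack,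
    stack_sub_stack]
  congr 2
  · simp only [Matrix.one_mul, Matrix.add_mul, Matrix.sub_mul, Matrix.smul_mul, Matrix.mul_smul,
      Matrix.neg_mul, Matrix.mul_assoc]
    module
  · simp only [Matrix.zero_mul, Matrix.add_mul, Matrix.sub_mul, Matrix.smul_mul, Matrix.mul_smul,
      Matrix.mul_assoc]
    module

theorem contDiff_geodesic (A : Matrix (Fin p) (Fin p) ℝ) (H : Matrix (Fin (n - p)) (Fin p) ℝ) :
    ContDiff ℝ ∞ (geodesic h β Q A H) := by
  have hexp {m : ℕ} (S : Matrix (Fin m) (Fin m) ℝ) :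
      ContDiff ℝ ∞ fun t : ℝ => NormedSpace.exp (t • S) :=
    contDiff_exp.comp (contDiff_id.smul contDiff_const)
  exact contDiff_matrix_mul (contDiff_matrix_mul (contDiff_matrix_mul contDiff_const (hexp _))
    contDiff_const) (hexp _)

theorem isGeodesic_geodesic (hQ : Q ∈ Matrix.orthogonalGroup (Fin n) ℝ)
    {A : Matrix (Fin p) (Fin p) ℝ} (hA : Aᵀ = -A) (H : Matrix (Fin (n - p)) (Fin p) ℝ) :
    IsGeodesic (metric β) (stiefel n p) tangent (geodesic h β Q A H) := by
  have hP (t : ℝ) : Q * NormedSpace.exp (t • omega h β A H) ∈ Matrix.orthogonalGroup (Fin n) ℝ :=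
    mul_exp_mem_orthogonalGroup hQ (transpose_smul_skew (transpose_omega h hA H) t)
  have hE (t : ℝ) : (NormedSpace.exp (t • ((1 - 2 * β) • A)))ᵀ *
      NormedSpace.exp (t • ((1 - 2 * β) • A)) = 1 :=
    transpose_exp_mul_exp (transpose_smul_skew (transpose_smul_skew hA _) t)
  refine isGeodesic_of_hasDerivAt (contDiff_geodesic h A H) (fun t => ?_)
    (hasDerivAt_geodesic h A H) (fun t => ?_)
  · change (geodesic h β Q A H t)ᵀ * geodesic h β Q A H t = 1
    have := mul_frame_mem_stiefel h (hP t)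
    change (_ * frame h)ᵀ * (_ * frame h) = 1 at this
    rw [geodesic, Matrix.transpose_mul _ (NormedSpace.exp (t • ((1 - 2 * β) • A))),
      Matrix.mul_assoc, ← Matrix.mul_assoc _ _ (NormedSpace.exp (t • ((1 - 2 * β) • A))), this,
      Matrix.one_mul, hE]
  · have hcomm : NormedSpace.exp (t • ((1 - 2 * β) • A)) * A =
        A * NormedSpace.exp (t • ((1 - 2 * β) • A)) :=
      (((Commute.refl A).smul_left (1 - 2 * β)).smul_left t).exp_left
    have := accel_mul_stack (β := β) h (hP t) hA (hE t) hcomm H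
    rw [geodesic, this]
    exact hasDerivAt_mul_exp_mul_exp Q (omega h β A H) (stack h A H) ((1 - 2 * β) • A) t

theorem geodesic_zero (A : Matrix (Fin p) (Fin p) ℝ) (H : Matrix (Fin (n - p)) (Fin p) ℝ) :
    geodesic h β Q A H 0 = Q * frame h := by
  simp [geodesic]

theorem deriv_geodesic_zero (A : Matrix (Fin p) (Fin p) ℝ) (H : Matrix (Fin (n - p)) (Fin p) ℝ) :
    deriv (geodesic h β Q A H) 0 = Q * stack h A H := by
  refine (hasDerivAt_geodesic h A H 0).deriv.trans ?_
  simp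

/-- The Riemannian exponential at `Q I_{n×p}` in closed form, extended to all matrices. -/
noncomputable def expFormula (β : ℝ) (Q : Matrix (Fin n) (Fin n) ℝ)
    (ξ : Matrix (Fin n) (Fin p) ℝ) : Matrix (Fin n) (Fin p) ℝ :=
  geodesic h β Q (upper h (Qᵀ * ξ)) (lower h (Qᵀ * ξ)) 1

theorem expFormula_mul_stack (hQ : Q ∈ Matrix.orthogonalGroup (Fin n) ℝ)
    (A : Matrix (Fin p) (Fin p) ℝ) (H : Matrix (Fin (n - p)) (Fin p) ℝ) :
    expFormula h β Q (Q * stack h A H) = geodesic h β Q A H 1 := by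
  rw [expFormula, ← Matrix.mul_assoc, transpose_mul_self_of_mem hQ, Matrix.one_mul, upper_stack,
    lower_stack]

theorem exists_eq_mul_stack (hQ : Q ∈ Matrix.orthogonalGroup (Fin n) ℝ)
    (ξ : Matrix (Fin n) (Fin p) ℝ) : ∃ A H, ξ = Q * stack h A H := by
  refine ⟨upper h (Qᵀ * ξ), lower h (Qᵀ * ξ), ?_⟩
  rw [stack_upper_lower, ← Matrix.mul_assoc, mul_eq_one_comm.1 (transpose_mul_self_of_mem hQ),
    Matrix.one_mul]

theorem riemExp_eq_expFormula (hβ : 0 < β) (hQ : Q ∈ Matrix.orthogonalGroup (Fin n) ℝ)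
    (ξ : tangent (Q * frame h)) :
    riemExp (metric β) (stiefel n p) tangent (Q * frame h) ξ = expFormula h β Q ξ := by
  obtain ⟨A, H, hξ⟩ := exists_eq_mul_stack h hQ (ξ : Matrix (Fin n) (Fin p) ℝ)
  have hA : Aᵀ = -A := (mul_stack_mem_tangent_iff h hQ).1 (hξ ▸ ξ.2)
  have hgeo := isGeodesic_geodesic (β := β) h hQ hA H
  have hex : ∃ γ, IsGeodesic (metric β) (stiefel n p) tangent γ ∧ γ 0 = Q * frame h ∧
      deriv γ 0 = (ξ : Matrix (Fin n) (Fin p) ℝ) :=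
    ⟨geodesic h β Q A H, hgeo, geodesic_zero h A H, hξ ▸ deriv_geodesic_zero h A H⟩
  obtain ⟨h1, h2, h3⟩ := Classical.choose_spec hex
  have := h1.unique hβ hgeo (h2.trans (geodesic_zero h A H).symm)
    (h3.trans (hξ.trans (deriv_geodesic_zero h A H).symm))
  rw [hξ, expFormula_mul_stack h hQ, ← this]
  exact dif_pos hex

theorem differentiable_expFormula : Differentiable ℝ (expFormula h β Q) := by
  let φ : Matrix (Fin n) (Fin p) ℝ →ₗ[ℝ] Matrix (Fin n) (Fin n) ℝ :=
    { toFun := fun ξ => omega h β (upper h (Qᵀ * ξ)) (lower h (Qᵀ * ξ))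
      map_add' := fun ξ η => by rw [omega_add, Matrix.mul_add]; rfl
      map_smul' := fun c ξ => by rw [RingHom.id_apply, smul_omega, Matrix.mul_smul]; rfl }
  let ψ : Matrix (Fin n) (Fin p) ℝ →ₗ[ℝ] Matrix (Fin p) (Fin p) ℝ :=
    { toFun := fun ξ => (1 - 2 * β) • upper h (Qᵀ * ξ)
      map_add' := fun ξ η => by rw [← smul_add, Matrix.mul_add]; rfl
      map_smul' := fun c ξ => by rw [RingHom.id_apply, smul_comm c, Matrix.mul_smul]; rfl }
  have hφ : ContDiff ℝ 1 fun ξ => NormedSpace.exp (φ ξ) :=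
    contDiff_exp.comp (LinearMap.toContinuousLinearMap φ).contDiff
  have hψ : ContDiff ℝ 1 fun ξ => NormedSpace.exp (ψ ξ) :=
    contDiff_exp.comp (LinearMap.toContinuousLinearMap ψ).contDiff
  have e : expFormula h β Q = fun ξ => Q * NormedSpace.exp (φ ξ) * frame h *
      NormedSpace.exp (ψ ξ) := by
    funext ξ
    simp only [expFormula, geodesic, one_smul]
    rfl
  rw [e]
  exact (contDiff_matrix_mul (contDiff_matrix_mul (contDiff_matrix_mul contDiff_const hφ)
    contDiff_const) hψ).differentiable one_ne_zero

/-- At a base point with zero upper block the right-hand exponential is 1 and its derivative is just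
the increment of its exponent. -/
theorem fderiv_expFormula (hQ : Q ∈ Matrix.orthogonalGroup (Fin n) ℝ)
    (H K : Matrix (Fin (n - p)) (Fin p) ℝ) (B : Matrix (Fin p) (Fin p) ℝ) :
    fderiv ℝ (expFormula h β Q) (Q * stack h 0 H) (Q * stack h B K) =
      Q * (fderiv ℝ NormedSpace.exp (omega h β 0 H) (omega h β B K) * frame h +
        NormedSpace.exp (omega h β 0 H) * frame h * ((1 - 2 * β) • B)) := by
  have hline {m q : ℕ} (X u : Matrix (Fin m) (Fin q) ℝ) :
      HasDerivAt (fun s : ℝ => X + s • u) u 0 := by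
    have := ((hasDerivAt_id (0 : ℝ)).smul_const u).const_add X
    rw [one_smul] at this
    exact this
  have h1 : HasDerivAt (fun s : ℝ => expFormula h β Q (Q * stack h 0 H + s • (Q * stack h B K)))
      (fderiv ℝ (expFormula h β Q) (Q * stack h 0 H) (Q * stack h B K)) 0 := by
    have hd : HasFDerivAt (expFormula h β Q) (fderiv ℝ (expFormula h β Q) (Q * stack h 0 H))
        (Q * stack h 0 H + (0 : ℝ) • (Q * stack h B K)) := by
      simpa using (differentiable_expFormula h (Q * stack h 0 H)).hasFDerivAt
    exact hd.comp_hasDerivAt 0 (hline _ _)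
  have hexp : HasDerivAt (fun s : ℝ => NormedSpace.exp (omega h β 0 H + s • omega h β B K))
      (fderiv ℝ NormedSpace.exp (omega h β 0 H) (omega h β B K)) 0 := by
    have hd : HasFDerivAt NormedSpace.exp (fderiv ℝ NormedSpace.exp (omega h β 0 H))
        (omega h β 0 H + (0 : ℝ) • omega h β B K) := by
      rw [zero_smul, add_zero]
      exact ((contDiff_exp (k := 1)).differentiable one_ne_zero (omega h β 0 H)).hasFDerivAt
    exact hd.comp_hasDerivAt 0 (hline _ _)
  have h2 := hasDerivAt_matrix_mul (hasDerivAt_matrix_mul (hasDerivAt_matrix_mul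
    (hasDerivAt_const 0 Q) hexp) (hasDerivAt_const 0 (frame h)))
    (hasDerivAt_exp_smul_const (𝕂 := ℝ) ((1 - 2 * β) • B) 0)
  have e : (fun s : ℝ => expFormula h β Q (Q * stack h 0 H + s • (Q * stack h B K))) =
      fun s => Q * NormedSpace.exp (omega h β 0 H + s • omega h β B K) * frame h *
        NormedSpace.exp (s • ((1 - 2 * β) • B)) := by
    funext s
    rw [← Matrix.mul_smul, ← Matrix.mul_add, smul_stack, stack_add_stack,
      expFormula_mul_stack h hQ, geodesic, one_smul, one_smul, smul_omega h s, omega_add,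
      zero_add, smul_comm s]
  rw [e] at h1
  rw [h1.unique h2]
  simp only [zero_smul, add_zero, NormedSpace.exp_zero, Matrix.mul_one, Matrix.one_mul,
    Matrix.mul_zero, Matrix.zero_mul, zero_add, Matrix.mul_add, Matrix.mul_assoc]
  exact add_comm _ _

theorem isCriticalPoint_of_fderiv_eq_zero (hβ : 0 < β) (hQ : Q ∈ Matrix.orthogonalGroup (Fin n) ℝ)
    (v w : tangent (Q * frame h)) (hw : w ≠ 0) (h0 : fderiv ℝ (expFormula h β Q) v w = 0) :
    IsCriticalPoint (metric β) (stiefel n p) tangent (Q * frame h) v := by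
  refine ⟨(fderiv ℝ (expFormula h β Q) v).comp (tangent (Q * frame h)).subtypeL, ?_, ?_⟩
  · have e : riemExp (metric β) (stiefel n p) tangent (Q * frame h) =
        expFormula h β Q ∘ (tangent (Q * frame h)).subtypeL :=
      funext (riemExp_eq_expFormula h hβ hQ)
    rw [e]
    exact (differentiable_expFormula h _).hasFDerivAt.comp v
      (tangent (Q * frame h)).subtypeL.hasFDerivAt
  · intro hinj
    refine hw (hinj ?_)
    exact h0.trans (map_zero _).symm

end Geodesics

/-! ### Kernel vectors of the derivative of the exponential map -/

section Kernel

theorem fderiv_exp_of_anticommute {𝔸 : Type*} [NormedRing 𝔸] [NormedAlgebra ℝ 𝔸] [CompleteSpace 𝔸]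
    {s m : 𝔸} (hs : s * s * s = -s) (hsm : m * s = -(s * m)) (hssm : s * s * m = -m) {t : ℝ}
    (ht : t ≠ 0) :
    fderiv ℝ (NormedSpace.exp : 𝔸 → 𝔸) (t • s) m = (Real.sin t / t) • m := by
  have h1 : s * (s * m) - s * m * s = (-2 : ℝ) • m := by
    rw [mul_assoc s m s, hsm, mul_neg, ← mul_assoc, hssm, neg_smul, two_smul]
    abel
  have h2 : s * s * (s * m) - s * m * (s * s) = 0 := by
    have : s * m * (s * s) = s * s * (s * m) := by
      rw [← mul_assoc, mul_assoc s m s, hsm, mul_neg, neg_mul, mul_assoc s (s * m) s,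
        mul_assoc s m s, hsm, mul_neg, mul_neg, neg_neg, mul_assoc]
    rw [this, sub_self]
  -- Since [s, sm] = -2m, this factor makes m the commutator of ts with it. As s² commutes with sm,
  -- only the sine term of Rodrigues' formula contributes.
  have key := fderiv_exp_commutator (t • s) ((-1 / (2 * t)) • (s * m))
  have e1 : (t • s) * ((-1 / (2 * t)) • (s * m)) - ((-1 / (2 * t)) • (s * m)) * (t • s) = m := by
    rw [smul_mul_smul_comm, smul_mul_smul_comm, mul_comm (-1 / (2 * t)) t, ← smul_sub, h1, smul_smul]
    convert one_smul ℝ m using 2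
    field_simp
  rw [e1, exp_smul_of_cube_eq_neg hs] at key
  rw [key]
  have e2 : (1 + Real.sin t • s + (1 - Real.cos t) • (s * s)) * ((-1 / (2 * t)) • (s * m)) -
      ((-1 / (2 * t)) • (s * m)) * (1 + Real.sin t • s + (1 - Real.cos t) • (s * s)) =
      (-1 / (2 * t)) • (Real.sin t • (s * (s * m) - s * m * s) +
        (1 - Real.cos t) • (s * s * (s * m) - s * m * (s * s))) := by
    simp only [add_mul, mul_add, one_mul, mul_one, smul_mul_assoc, mul_smul_comm, smul_add,
      smul_sub]
    simp only [smul_comm (-1 / (2 * t))]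
    abel
  rw [e2, h1, h2, smul_zero, add_zero, smul_smul, smul_smul]
  congr 1
  field_simp

variable {n p : ℕ} (h : p ≤ n) {β : ℝ} {Q : Matrix (Fin n) (Fin n) ℝ}
  {H : Matrix (Fin (n - p)) (Fin p) ℝ} {J : Matrix (Fin p) (Fin p) ℝ}

theorem omega_zero_cube (hH : H * Hᵀ * H = H) :
    omega h β 0 H * omega h β 0 H * omega h β 0 H = -omega h β 0 H := by
  have hH' : Hᵀ * H * Hᵀ = Hᵀ := by
    have := congrArg Matrix.transpose hH
    simpa [Matrix.mul_assoc] using this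
  simp only [omega_eq_block, block_mul_block, neg_block, smul_zero, Matrix.zero_mul,
    Matrix.mul_zero, zero_add, add_zero, Matrix.neg_mul, Matrix.mul_neg, neg_neg, neg_zero, hH, hH']

theorem exp_omega_mul_frame_mul (hH : H * Hᵀ * H = H) (hJ : Hᵀ * H * J = J) (t : ℝ) :
    NormedSpace.exp (t • omega h β 0 H) * frame h * J =
      stack h (Real.cos t • J) (Real.sin t • (H * J)) := by
  have e : NormedSpace.exp (t • omega h β 0 H) = 1 + Real.sin t • omega h β 0 H +
      (1 - Real.cos t) • (omega h β 0 H * omega h β 0 H) :=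
    exp_smul_of_cube_eq_neg (omega_zero_cube h hH) t
  rw [e, frame, Matrix.mul_assoc, stack_mul,
    omega_eq_block, block_mul_block]
  simp only [Matrix.add_mul, Matrix.one_mul, Matrix.smul_mul, block_mul_stack, smul_stack,
    stack_add_stack]
  congr 1
  · simp only [Matrix.zero_mul, Matrix.mul_zero, smul_zero, add_zero, zero_add, Matrix.neg_mul, hJ]
    module
  · simp

/-- The direction is βa N + M, where N commutes and M anticommutes with `omega h β 0 H`; the
derivative of exp is known on each part. -/
theorem fderiv_exp_omega (hH : H * Hᵀ * H = H) (hJ : Hᵀ * H * J = J) (hJs : Jᵀ = -J) {t : ℝ}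
    (ht : t ≠ 0) (a k : ℝ) :
    fderiv ℝ NormedSpace.exp (t • omega h β 0 H) (omega h β (a • J) (k • (H * J))) * frame h =
      (β * a) • (NormedSpace.exp (t • omega h β 0 H) * frame h * J) +
        (Real.sin t / t) • stack h ((β * a) • J) (k • (H * J)) := by
  have hJ' : J * (Hᵀ * H) = J := by
    have := congrArg Matrix.transpose hJ
    simpa [hJs, Matrix.mul_assoc] using this
  have hHJ : (H * J)ᵀ = -(J * Hᵀ) := by simp [hJs]
  have r1 : Hᵀ * (H * (J * Hᵀ)) = J * Hᵀ := by
    rw [← Matrix.mul_assoc, ← Matrix.mul_assoc, hJ]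
  have r2 : Hᵀ * (H * J) = J := by rw [← Matrix.mul_assoc, hJ]
  -- N transports J to the lower block through H, which makes it commute. M compensates the lower
  -- block that N adds, and carries the off-diagonal part.
  let N := block h J 0 0 (H * (J * Hᵀ))
  let M := block h ((β * a) • J) (k • (J * Hᵀ)) (k • (H * J)) (-((β * a) • (H * (J * Hᵀ))))
  have hsplit : omega h β (a • J) (k • (H * J)) = (β * a) • N + M := by
    simp only [N, M, omega_eq_block, smul_block, block_add_block, Matrix.transpose_smul, hHJ]
    congr 1
    · module
    · module
    · module
    · module
  have hN : Commute (t • omega h β 0 H) ((β * a) • N) := by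
    refine (Commute.smul_left ?_ _).smul_right _
    simp only [Commute, SemiconjBy, N, omega_eq_block, block_mul_block, smul_zero,
      Matrix.zero_mul, Matrix.mul_zero, zero_add, add_zero, Matrix.neg_mul, Matrix.mul_neg, r1,
      Matrix.mul_assoc, hJ', neg_zero]
  have hM1 : M * omega h β 0 H = -(omega h β 0 H * M) := by
    simp only [M, omega_eq_block, block_mul_block, neg_block, smul_zero,
      Matrix.zero_mul, Matrix.mul_zero, zero_add, add_zero, Matrix.neg_mul, Matrix.mul_neg, r1, r2,
      Matrix.mul_smul, Matrix.smul_mul, Matrix.mul_assoc, hJ', neg_neg,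
      smul_neg, neg_zero]
  have hM2 : omega h β 0 H * omega h β 0 H * M = -M := by
    simp only [M, omega_eq_block, block_mul_block, neg_block, smul_zero,
      Matrix.zero_mul, Matrix.mul_zero, zero_add, add_zero, Matrix.neg_mul, Matrix.mul_neg, r1, r2,
      Matrix.mul_smul, Matrix.mul_assoc, neg_neg, smul_neg, neg_zero]
  have e1 := fderiv_exp_of_commute hN
  have e2 := fderiv_exp_of_anticommute (omega_zero_cube h hH) hM1 hM2 ht
  have e3 : N * frame h = frame h * J := by
    simp [N, frame, block_mul_stack, stack_mul]
  have e4 : M * frame h = stack h ((β * a) • J) (k • (H * J)) := by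
    simp [M, frame, block_mul_stack]
  have e5 : fderiv ℝ NormedSpace.exp (t • omega h β 0 H) (omega h β (a • J) (k • (H * J))) =
      NormedSpace.exp (t • omega h β 0 H) * ((β * a) • N) + (Real.sin t / t) • M := by
    rw [hsplit]
    exact (map_add _ _ _).trans (congrArg₂ (· + ·) e1 e2)
  rw [e5, Matrix.add_mul, Matrix.smul_mul, e4, Matrix.mul_smul, Matrix.smul_mul, Matrix.mul_assoc,
    e3, Matrix.mul_assoc]

/-- `h1` and `h2` are the vanishing of the coefficients of J in the upper block and of HJ in the
lower one. -/
theorem fderiv_expFormula_eq_zero (hQ : Q ∈ Matrix.orthogonalGroup (Fin n) ℝ)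
    (hH : H * Hᵀ * H = H) (hJ : Hᵀ * H * J = J) (hJs : Jᵀ = -J) {t a k : ℝ} (ht : t ≠ 0)
    (h1 : (1 - β) * a * Real.cos t + β * a * (Real.sin t / t) = 0)
    (h2 : (1 - β) * a * Real.sin t + k * (Real.sin t / t) = 0) :
    fderiv ℝ (expFormula h β Q) (Q * stack h 0 (t • H)) (Q * stack h (a • J) (k • (H * J))) = 0 := by
  have e : omega h β 0 (t • H) = t • omega h β 0 H := by rw [smul_omega, smul_zero]
  rw [fderiv_expFormula h hQ, e, fderiv_exp_omega h hH hJ hJs ht, Matrix.mul_smul, Matrix.mul_smul,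
    exp_omega_mul_frame_mul h hH hJ]
  simp only [smul_stack, stack_add_stack]
  have e1 : (β * a) • Real.cos t • J + (Real.sin t / t) • (β * a) • J +
      (1 - 2 * β) • a • Real.cos t • J = 0 := by
    have := congrArg (· • J) h1
    simp only [zero_smul] at this
    rw [← this]
    module
  have e2 : (β * a) • Real.sin t • (H * J) + (Real.sin t / t) • k • (H * J) +
      (1 - 2 * β) • a • Real.sin t • (H * J) = 0 := by
    have := congrArg (· • (H * J)) h2
    simp only [zero_smul] at this
    rw [← this]
    module
  rw [e1, e2, stack_zero, Matrix.mul_zero]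

theorem isCriticalPoint_of_eq_zero (hβ : 0 < β) (hQ : Q ∈ Matrix.orthogonalGroup (Fin n) ℝ)
    (hH : H * Hᵀ * H = H) (hJ : Hᵀ * H * J = J) (hJs : Jᵀ = -J) (hJ0 : J ≠ 0) {t a k : ℝ}
    (ht : t ≠ 0) (h0 : a ≠ 0 ∨ k ≠ 0)
    (h1 : (1 - β) * a * Real.cos t + β * a * (Real.sin t / t) = 0)
    (h2 : (1 - β) * a * Real.sin t + k * (Real.sin t / t) = 0) (v : tangent (Q * frame h))
    (hv : (v : Matrix (Fin n) (Fin p) ℝ) = Q * stack h 0 (t • H)) :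
    IsCriticalPoint (metric β) (stiefel n p) tangent (Q * frame h) v := by
  refine isCriticalPoint_of_fderiv_eq_zero h hβ hQ v ⟨Q * stack h (a • J) (k • (H * J)),
    (mul_stack_mem_tangent_iff h hQ).2 (transpose_smul_skew hJs a)⟩ ?_ ?_
  · intro hw
    have hw : Q * stack h (a • J) (k • (H * J)) = 0 := congrArg Subtype.val hw
    have hw : stack h (a • J) (k • (H * J)) = 0 := by
      have := congrArg (Qᵀ * ·) hw
      simpa [← Matrix.mul_assoc, transpose_mul_self_of_mem hQ] using this
    rw [← stack_zero h] at hw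
    have ha := congrArg (upper h) hw
    have hk := congrArg (lower h) hw
    simp only [upper_stack, lower_stack, smul_eq_zero, hJ0, or_false] at ha hk
    have hHJ : H * J ≠ 0 := fun h0 => hJ0 (by rw [← hJ, Matrix.mul_assoc, h0, Matrix.mul_zero])
    rcases h0 with h0 | h0
    · exact h0 ha
    · exact hk.elim h0 hHJ
  · rw [hv]
    exact fderiv_expFormula_eq_zero h hQ hH hJ hJs ht h1 h2

theorem isCriticalPoint_tRoot (hβ : 0 < β) (hQ : Q ∈ Matrix.orthogonalGroup (Fin n) ℝ)
    (hH : H * Hᵀ * H = H) (hJ : Hᵀ * H * J = J) (hJs : Jᵀ = -J) (hJ0 : J ≠ 0)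
    (v : tangent (Q * frame h))
    (hv : (v : Matrix (Fin n) (Fin p) ℝ) = Q * stack h 0 (tRoot β • H)) :
    IsCriticalPoint (metric β) (stiefel n p) tangent (Q * frame h) v := by
  have hmem := (isLeast_tRoot hβ).1
  have ht := hmem.1
  have hroot := (mem_rootSet_iff ht).1 hmem
  -- With a = 1 the first equation is β times the root equation, and this k solves the second.
  refine isCriticalPoint_of_eq_zero h hβ hQ hH hJ hJs hJ0 (a := 1) (k := -((1 - β) * tRoot β))
    ht.ne' (Or.inl one_ne_zero) ?_ ?_ v hv
  · field_simp at hroot ⊢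
    linarith
  · field_simp
    ring

theorem isCriticalPoint_pi (hβ : 0 < β) (hQ : Q ∈ Matrix.orthogonalGroup (Fin n) ℝ)
    (hH : H * Hᵀ * H = H) (hJ : Hᵀ * H * J = J) (hJs : Jᵀ = -J) (hJ0 : J ≠ 0)
    (v : tangent (Q * frame h))
    (hv : (v : Matrix (Fin n) (Fin p) ℝ) = Q * stack h 0 (Real.pi • H)) :
    IsCriticalPoint (metric β) (stiefel n p) tangent (Q * frame h) v :=
  isCriticalPoint_of_eq_zero h hβ hQ hH hJ hJs hJ0 (a := 0) (k := 1) Real.pi_ne_zero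
    (Or.inr one_ne_zero) (by simp) (by simp) v hv

end Kernel

/-! ### The specific H and J, homogeneity, and the radius bound -/

section ConjugateRadius

variable {n p : ℕ}

theorem hMat_transpose_mul_apply (hn : p + 2 ≤ n) (i j : Fin p) :
    ((hMat n p)ᵀ * hMat n p) i j = if i = j ∧ (i : ℕ) < 2 then 1 else 0 := by
  rw [Matrix.mul_apply]
  by_cases hi : (i : ℕ) < 2
  · rw [Finset.sum_eq_single (⟨i, by omega⟩ : Fin (n - p))]
    · simp only [hMat, Matrix.transpose_apply, Matrix.of_apply, Fin.ext_iff]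
      grind
    · intro b _ hb
      have : (b : ℕ) ≠ i := fun e => hb (Fin.ext e)
      simp [hMat, this]
    · simp
  · refine (Finset.sum_eq_zero fun b _ => ?_).trans (by simp [hi])
    simp only [hMat, Matrix.transpose_apply, Matrix.of_apply, hi, and_false, if_false, zero_mul]

theorem hMat_transpose_mul (hn : p + 2 ≤ n) :
    (hMat n p)ᵀ * hMat n p = Matrix.diagonal fun i : Fin p => if (i : ℕ) < 2 then 1 else 0 := by
  ext i j
  rw [hMat_transpose_mul_apply hn, Matrix.diagonal_apply]
  grind

theorem hMat_mul_transpose_mul (hn : p + 2 ≤ n) :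
    hMat n p * (hMat n p)ᵀ * hMat n p = hMat n p := by
  rw [Matrix.mul_assoc, hMat_transpose_mul hn]
  ext i j
  rw [Matrix.mul_diagonal]
  simp only [hMat, Matrix.of_apply]
  grind

theorem trace_hMat (hp : 2 ≤ p) (hn : p + 2 ≤ n) : ((hMat n p)ᵀ * hMat n p).trace = 2 := by
  rw [hMat_transpose_mul hn, Matrix.trace_diagonal]
  obtain ⟨q, rfl⟩ := Nat.exists_eq_add_of_le' hp
  rw [Fin.sum_univ_succ, Fin.sum_univ_succ]
  simp
  norm_num

/-- The infinitesimal rotation of the first two coordinates of `ℝᵖ`. -/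
def rotation (p : ℕ) : Matrix (Fin p) (Fin p) ℝ :=
  Matrix.of fun i j => if (i : ℕ) = 1 ∧ (j : ℕ) = 0 then 1
    else if (i : ℕ) = 0 ∧ (j : ℕ) = 1 then -1 else 0

theorem transpose_rotation : (rotation p)ᵀ = -rotation p := by
  ext i j
  simp only [rotation, Matrix.transpose_apply, Matrix.of_apply, Matrix.neg_apply]
  split_ifs <;> first | omega | simp

theorem hMat_transpose_mul_mul_rotation (hn : p + 2 ≤ n) :
    (hMat n p)ᵀ * hMat n p * rotation p = rotation p := by
  rw [hMat_transpose_mul hn]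
  ext i j
  rw [Matrix.diagonal_mul]
  simp only [rotation, Matrix.of_apply]
  split_ifs <;> first | omega | simp

theorem rotation_ne_zero (hp : 2 ≤ p) : rotation p ≠ 0 := by
  intro h0
  have := congrFun (congrFun h0 ⟨1, by omega⟩) ⟨0, by omega⟩
  simp [rotation] at this

theorem mul_frame_apply (h : p ≤ n) (Q : Matrix (Fin n) (Fin n) ℝ) (k : Fin n) (j : Fin p) :
    (Q * frame h) k j = Q k (split h (Sum.inl j)) := by
  rw [Matrix.mul_apply, ← (split h).sum_comp, Fintype.sum_sum_type]
  simp [frame, stack, Matrix.one_apply]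

/-- The columns of `X` are completed to an orthonormal basis, whose vectors are the columns of Q. -/
theorem exists_eq_mul_frame (h : p ≤ n) {X : Matrix (Fin n) (Fin p) ℝ} (hX : X ∈ stiefel n p) :
    ∃ Q ∈ Matrix.orthogonalGroup (Fin n) ℝ, X = Q * frame h := by
  have hX' : Xᵀ * X = 1 := hX
  -- The zeros at the last n - p indices are placeholders: the extension keeps the values on `s`
  -- only.
  let v : Fin n → EuclideanSpace ℝ (Fin n) := fun i =>
    Sum.elim (fun j => WithLp.toLp 2 fun k => X k j) (fun _ => 0) ((split h).symm i)
  let s : Set (Fin n) := Set.range (split h ∘ Sum.inl)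
  have hv : Orthonormal ℝ (s.domRestrict v) := by
    rw [orthonormal_iff_ite]
    rintro ⟨_, i, rfl⟩ ⟨_, j, rfl⟩
    have := congrFun (congrFun hX' j) i
    rw [Matrix.mul_apply, Matrix.one_apply] at this
    simp only [Set.domRestrict_apply, Function.comp_apply, v, Equiv.symm_apply_apply,
      Sum.elim_inl, PiLp.inner_apply, Subtype.mk.injEq, EmbeddingLike.apply_eq_iff_eq,
      Sum.inl.injEq]
    simpa [eq_comm] using this
  obtain ⟨b, hb⟩ := hv.exists_orthonormalBasis_extension_of_card_eq (by simp)
  refine ⟨Matrix.of fun k i => b i k, ?_, ?_⟩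
  · rw [Matrix.mem_orthogonalGroup_iff']
    ext i j
    have := (orthonormal_iff_ite.1 b.orthonormal) j i
    rw [PiLp.inner_apply] at this
    rw [Matrix.mul_apply, Matrix.one_apply]
    simpa [Matrix.star_eq_conjTranspose, eq_comm] using this
  · ext k j
    have e : b (split h (Sum.inl j)) = v (split h (Sum.inl j)) := hb _ ⟨j, rfl⟩
    rw [mul_frame_apply, Matrix.of_apply, e]
    simp [v]

/-- The critical vector has norm t√2, because tr(HᵀH) = 2, so it lies in every open ball of larger
radius. -/
theorem conjRadiusAt_le {β t : ℝ} (hp : 2 ≤ p) (hn : p + 2 ≤ n) (h : p ≤ n) (ht : 0 ≤ t)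
    {Q : Matrix (Fin n) (Fin n) ℝ} (hQ : Q ∈ Matrix.orthogonalGroup (Fin n) ℝ)
    (hcrit : ∀ v : tangent (Q * frame h),
      (v : Matrix (Fin n) (Fin p) ℝ) = Q * stack h 0 (t • hMat n p) →
      IsCriticalPoint (metric β) (stiefel n p) tangent (Q * frame h) v) :
    conjRadiusAt (metric β) (stiefel n p) tangent (Q * frame h) ≤ ENNReal.ofReal (t * √2) := by
  refine iSup₂_le fun r hr => ?_
  have hmem : Q * stack h 0 (t • hMat n p) ∈ tangent (Q * frame h) :=
    (mul_stack_mem_tangent_iff h hQ).2 (by simp)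
  have hnorm : metricNorm (metric β) (Q * frame h) (Q * stack h 0 (t • hMat n p)) = t * √2 := by
    rw [metricNorm, metric_apply h β Q hQ, Matrix.transpose_smul, Matrix.smul_mul, Matrix.mul_smul,
      smul_smul, Matrix.trace_smul, trace_hMat hp hn]
    simp only [Matrix.transpose_zero, Matrix.trace_zero, mul_zero, zero_add, smul_eq_mul]
    rw [Real.sqrt_mul (mul_self_nonneg t), Real.sqrt_mul_self ht]
  have hle : (r : ℝ) ≤ t * √2 := by
    by_contra! hlt
    exact hr ⟨_, hmem⟩ (hnorm ▸ hlt) (hcrit _ rfl)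
  rw [← ENNReal.ofReal_coe_nnreal]
  exact ENNReal.ofReal_le_ofReal hle

end ConjugateRadius

end StiefelConj

open StiefelConj in
theorem theorem5p1 (n p : ℕ) (hp : 2 ≤ p) (hn : p + 2 ≤ n) (hpn : p ≤ n) (β : ℝ) (hβ : 0 < β)
    (Q : Matrix (Fin n) (Fin n) ℝ) (hQ : Q ∈ Matrix.orthogonalGroup (Fin n) ℝ)
    (ξ : Matrix (Fin n) (Fin p) ℝ) (hξ : ξ = Q * stack hpn 0 (hMat n p))
    (γ : ℝ → Matrix (Fin n) (Fin p) ℝ)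
    (hγ : γ = fun t => Q * NormedSpace.exp (t • omega hpn β 0 (hMat n p)) * frame hpn) :
    -- the set of positive roots has a smallest element, `tRoot β`
    IsLeast (rootSet β) (tRoot β) ∧
    -- `γ` is the geodesic starting at `Q I_{n×p}` in the direction of the tangent vector `ξ`
    (Q * frame hpn ∈ stiefel n p ∧ ξ ∈ tangent (Q * frame hpn) ∧
      ∀ c : ℝ → Matrix (Fin n) (Fin p) ℝ,
        (IsGeodesic (metric β) (stiefel n p) tangent c ∧ c 0 = Q * frame hpn ∧ deriv c 0 = ξ)
          ↔ c = γ) ∧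
    -- conjugate points
    IsConjugateAlong (metric β) (stiefel n p) tangent γ (tRoot β) ∧
    IsConjugateAlong (metric β) (stiefel n p) tangent γ Real.pi ∧
    -- speed and length
    (∀ t, metricNorm (metric β) (γ t) (deriv γ t) = √2) ∧
    (∀ T > 0, curveLength (metric β) γ 0 T = T * √2) ∧
    -- conjugate radius, at every point and of the manifold
    (∀ X ∈ stiefel n p, conjRadiusAt (metric β) (stiefel n p) tangent X ≤
      ENNReal.ofReal (min (tRoot β) Real.pi * √2)) ∧
    conjRadius (metric β) (stiefel n p) tangent ≤
      ENNReal.ofReal (min (tRoot β) Real.pi * √2) ∧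
    (β ≤ 1 → min (tRoot β) Real.pi = tRoot β) ∧
    (1 ≤ β → min (tRoot β) Real.pi = Real.pi) := by
  have hH := hMat_mul_transpose_mul hn
  have hJ := hMat_transpose_mul_mul_rotation hn
  have hJ0 := rotation_ne_zero hp
  have hskew : (0 : Matrix (Fin p) (Fin p) ℝ)ᵀ = -0 := by simp
  have hγ' : γ = geodesic hpn β Q 0 (hMat n p) := by
    rw [hγ]
    funext t
    simp [geodesic]
  have hgeo : IsGeodesic (metric β) (stiefel n p) tangent γ :=
    hγ' ▸ isGeodesic_geodesic hpn hQ hskew _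
  have hγ0 : γ 0 = Q * frame hpn := hγ' ▸ geodesic_zero hpn _ _
  have hdγ0 : deriv γ 0 = ξ := hγ' ▸ hξ ▸ deriv_geodesic_zero hpn _ _
  have hmem := mul_frame_mem_stiefel hpn hQ
  have htan : ξ ∈ tangent (Q * frame hpn) := hξ ▸ (mul_stack_mem_tangent_iff hpn hQ).2 hskew
  have hconj (t : ℝ) (hcrit : ∀ v : tangent (Q * frame hpn),
      (v : Matrix (Fin n) (Fin p) ℝ) = Q * stack hpn 0 (t • hMat n p) →
      IsCriticalPoint (metric β) (stiefel n p) tangent (Q * frame hpn) v) :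
      IsConjugateAlong (metric β) (stiefel n p) tangent γ t := by
    refine ⟨hgeo, ?_⟩
    rw [hγ0]
    refine ⟨⟨t • ξ, Submodule.smul_mem _ t htan⟩, ?_, hcrit _ ?_⟩
    · exact congrArg (t • ·) hdγ0.symm
    · change t • ξ = _
      rw [hξ, ← Matrix.mul_smul, smul_stack, smul_zero]
  have hspeed (t : ℝ) : metricNorm (metric β) (γ t) (deriv γ t) = √2 := by
    have e1 : deriv γ t = Q * NormedSpace.exp (t • omega hpn β 0 (hMat n p)) *
        stack hpn 0 (hMat n p) := by
      rw [hγ']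
      refine (hasDerivAt_geodesic hpn _ _ t).deriv.trans ?_
      simp
    have hP := mul_exp_mem_orthogonalGroup hQ
      (transpose_smul_skew (transpose_omega hpn (β := β) hskew (hMat n p)) t)
    have e2 := metric_apply hpn β _ hP 0 0 (hMat n p) (hMat n p)
    rw [metricNorm]
    refine congrArg Real.sqrt ?_
    have e3 : γ t = Q * NormedSpace.exp (t • omega hpn β 0 (hMat n p)) * frame hpn := by rw [hγ]
    refine (congrArg₂ (fun a b => metric β a b b) e3 e1).trans (e2.trans ?_)
    rw [trace_hMat hp hn]
    simp
  have hrad (X : Matrix (Fin n) (Fin p) ℝ) (hX : X ∈ stiefel n p) :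
      conjRadiusAt (metric β) (stiefel n p) tangent X ≤
        ENNReal.ofReal (min (tRoot β) Real.pi * √2) := by
    obtain ⟨P, hP, rfl⟩ := exists_eq_mul_frame hpn hX
    rcases min_choice (tRoot β) Real.pi with h | h <;> rw [h]
    · exact conjRadiusAt_le hp hn hpn (isLeast_tRoot hβ).1.1.le hP
        (isCriticalPoint_tRoot hpn hβ hP hH hJ transpose_rotation hJ0)
    · exact conjRadiusAt_le hp hn hpn Real.pi_pos.le hP
        (isCriticalPoint_pi hpn hβ hP hH hJ transpose_rotation hJ0)
  refine ⟨isLeast_tRoot hβ, ⟨hmem, htan, fun c => ⟨fun hc => ?_, ?_⟩⟩,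
    hconj _ (isCriticalPoint_tRoot hpn hβ hQ hH hJ transpose_rotation hJ0),
    hconj _ (isCriticalPoint_pi hpn hβ hQ hH hJ transpose_rotation hJ0), hspeed, fun T _ => ?_,
    hrad, (iInf₂_le _ hmem).trans (hrad _ hmem), fun h => min_eq_left (tRoot_le_pi hβ h),
    fun h => min_eq_right (pi_le_tRoot h)⟩
  · exact hc.1.unique hβ hgeo (hc.2.1.trans hγ0.symm) (hc.2.2.trans hdγ0.symm)
  · rintro rfl
    exact ⟨hgeo, hγ0, hdγ0⟩
  · exact (intervalIntegral.integral_congr (g := fun _ => √2) fun t _ => hspeed t).trans (by simp)
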